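/- **Theorem (causal (anti)commutators of the $N=4$ multiplet).** *Conventions.* $g=\mathrm{diag}(1,-1,-1,-1)$; $\sigma^\mu$ are the Pauli matrices with $\sigma^0=\mathbf 1$; $\epsilon_{12}=1$, $\epsilon^{ab}=-\epsilon_{ab}$; $\epsilon_{jklm}$ is totally antisymmetric with sign normalization $+1$ on the ordered indices; repeated indices are summed. $D_0=D_0^{(+)}+D_0^{(-)}$ is the massless Pauli–Jordan distribution, with $D_0^{(+)}(x)=\frac{i}{(2\pi)^3}\int\frac{d^3k}{2|k|}e^{-ip\cdot x}$, $p=(|k|,k)$, and $D_0^{(-)}(x)=-D_0^{(+)}(-x)$. *The multiplet.* Consider operator-valued fields $\phi_{jk}=-\phi_{kj}$ (complex scalars), $F_{ab}$ (Bosonic), $\lambda_{ja}$ (Fermionic spinors), $j,k=1,\dots,4$, $a,b=1,2$, with adjoints $\phi^*_{jk}$, $F^*_{\bar a\bar b}$, $\bar\lambda_{j\bar a}$, and supercharges $Q_{ja}$, $\bar Q_{j\bar a}=(Q_{ja})^\dagger$ (adjoints with respect to a non-degenerate Hermitian form on the common invariant domain of states; in a Hilbert space this is the scalar product), such that $$i[Q_{ja},\phi_{kl}]=\epsilon_{jklm}\lambda_{ma},\qquad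 i[\bar Q_{j\bar a},\phi_{kl}]=\delta_{jk}\bar\lambda_{l\bar a}-\delta_{jl}\bar\lambda_{k\bar a},$$ $$\{Q_{ja},\lambda_{kb}\}=\delta_{jk}F_{ab},\qquad \{Q_{ja},\bar\lambda_{k\bar b}\}=2\sigma^\mu_{a\bar b}\partial_\mu\phi_{jk},$$ $$[Q_{ja},F_{bc}]=0,\qquad [\bar Q_{j\bar a},F_{bc}]=-2i\,\sigma^\mu_{c\bar a}\partial_\mu\lambda_{jb},$$ subject to the constraints $$\partial^2\phi_{jk}=0,\quad \partial^2F_{ab}=0,\quad \sigma^\mu_{a\bar b}\partial_\mu\bar\lambda_j^{\bar b}=0,\quad F_{ab}=F_{ba},\quad \sigma^\mu_{a\bar b}\epsilon^{ac}\partial_\mu F_{cd}=0,\quad \epsilon_{jklm}\phi_{lm}=2\phi^*_{jk},$$ and suppose that the fields are free, i.e. the graded commutator of any two of them (anticommutator for two Fermionic fields, commutator otherwise) is a multiple of the identity. Let $$F_{\mu\nu}=\tfrac i2\left(\mathcal F_{\mu\nu}-\mathcal F^*_{\mu\nu}\right),\qquad \mathcal F^{\mu\nu}=-\tfrac12\sigma^{\mu\nu}_{ab}F^{ab},\qquad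 F^{ab}=\epsilon^{ac}\epsilon^{bd}F_{cd},$$ with $\sigma^{\mu\nu}_{ab}=\frac i4\left(\sigma^\mu_{a\bar c}\epsilon^{\bar c\bar d}\sigma^\nu_{b\bar d}-\sigma^\nu_{a\bar c}\epsilon^{\bar c\bar d}\sigma^\mu_{b\bar d}\right)$. *Statement.* (1) Suppose that $$[\phi_{jk}(x),\phi^*_{lm}(y)]=-i\,(\delta_{jl}\delta_{km}-\delta_{jm}\delta_{kl})\,D_0(x-y).$$ Then $$[F_{ab}(x),F^*_{\bar c\bar d}(y)]=2i\left(\sigma^\mu_{a\bar c}\sigma^\nu_{b\bar d}+\sigma^\mu_{a\bar d}\sigma^\nu_{b\bar c}\right)\partial_\mu\partial_\nu D_0(x-y),$$ $$\{\lambda_{ja}(x),\bar\lambda_{k\bar b}(y)\}=2\,\delta_{jk}\,\sigma^\mu_{a\bar b}\,\partial_\mu D_0(x-y),$$ and all other (anti)commutators of the fields and their adjoints are zero, except those obtained from the three displayed ones by taking adjoints or exchanging arguments, and the ones $[\phi_{jk}(x),\phi_{lm}(y)]=[\phi^*_{jk}(x),\phi^*_{lm}(y)]=-i\,\epsilon_{jklm}D_0(x-y)$,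 forced by the relation $2\phi^*_{jk}=\epsilon_{jklm}\phi_{lm}$. Moreover $$[F_{\mu\nu}(x),F_{\rho\sigma}(y)]=-\tfrac i2\left(g_{\mu\rho}\partial_\nu\partial_\sigma-g_{\nu\rho}\partial_\mu\partial_\sigma+g_{\nu\sigma}\partial_\mu\partial_\rho-g_{\mu\sigma}\partial_\nu\partial_\rho\right)D_0(x-y).$$ (2) In every multiplet as above, the relation for $[F_{ab},F^*_{\bar c\bar d}]$ and the relation for $[F_{\mu\nu},F_{\rho\sigma}]$ are equivalent. (3) The commutators $[\phi_{jk},\phi^*_{lm}]$ and $[\phi_{jk},\phi_{lm}]$ are covariant under $\phi_{jk}\mapsto U_{jl}U_{km}\phi_{lm}$, $U\in SU(4)$ (in particular $U\in SO(4)$). (4) All these (anti)commutators are compatible, in each of their two arguments, with the constraints above and their adjoints, and the commutator of $F_{\mu\nu}$ is compatible with $F_{\mu\nu}=-F_{\nu\mu}$, $\partial^\mu F_{\mu\nu}=0$, $\epsilon^{\mu\nu\alpha\beta}\partial_\beta F_{\mu\nu}=0$: the distributions on the right-hand sides satisfy the corresponding equations. (5) The positivity condition holds: the $2$-point functions obtained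 from the (anti)commutators by the substitution $D_0\to D_0^{(+)}$ are positive semidefinite, i.e. for all test functions $f_I$ the number $\sum_{I,J}\langle\Omega,X_I^*(\bar f_I)X_J(f_J)\Omega\rangle$ computed from them is real and $\ge 0$. Here $X_I$ runs through all the Bosonic fields $\phi_{jk},\phi^*_{jk},F_{ab},F^*_{\bar a\bar b}$, or through all the Fermionic fields $\lambda_{ja},\bar\lambda_{j\bar a}$, or through the fields $F_{\mu\nu}$. -/

import Mathlib

open scoped SchwartzMap ComplexConjugate

noncomputable section

namespace N4

/-! ### Minkowski space, test functions, Pauli-Jordan distribution -/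

/-- Minkowski space `ℝ⁴`, coordinates `x 0` (time), `x 1`, `x 2`, `x 3`. -/
abbrev Spacetime : Type := EuclideanSpace ℝ (Fin 4)

/-- Complex test functions. -/
abbrev Test : Type := 𝓢(Spacetime, ℂ)

/-- The partial derivative `∂_μ = ∂/∂x^μ` of a test function. -/
def pd (μ : Fin 4) (f : Test) : Test :=
  LineDeriv.lineDerivOp (EuclideanSpace.single μ (1 : ℝ) : Spacetime) f

/-- The complex conjugate test function. -/
def testConj (f : Test) : Test :=
  SchwartzMap.postcompCLM (𝕜 := ℝ) (Complex.conjCLE : ℂ →L[ℝ] ℂ) f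

/-- The Minkowski metric `diag(1,-1,-1,-1)` (the same numbers with upper indices). -/
def metric (μ ν : Fin 4) : ℂ := if μ = ν then (if μ = 0 then 1 else -1) else 0

/-- `p · x = ‖k‖ x⁰ - k · x⃗` for the momentum `p = (‖k‖, k)` on the forward light cone. -/
def coneDot (k : EuclideanSpace ℝ (Fin 3)) (x : Spacetime) : ℝ :=
  ‖k‖ * x 0 - ∑ i : Fin 3, k i * x i.succ

/-- `∫ f(x) exp(i s p·x) d⁴x` for `p = (‖k‖, k)`. -/
def coneFourier (s : ℝ) (f : Test) (k : EuclideanSpace ℝ (Fin 3)) : ℂ :=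
  ∫ x : Spacetime, Complex.exp (Complex.I * ((s * coneDot k x : ℝ) : ℂ)) * f x

/-- The positive frequency part of the massless Pauli-Jordan distribution,
`D₀⁽⁺⁾(x) = i (2π)⁻³ ∫ d³k / (2‖k‖) exp(-i p·x)`, as the kernel `D₀⁽⁺⁾(x - y)` smeared with
`f(x) g(y)`. -/
def pauliJordanPlus (f g : Test) : ℂ :=
  Complex.I / (2 * (Real.pi : ℂ)) ^ 3 *
    ∫ k : EuclideanSpace ℝ (Fin 3),
      (1 / (2 * (‖k‖ : ℂ))) * coneFourier (-1) f k * coneFourier 1 g k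

/-- The massless Pauli-Jordan causal distribution `D₀(x - y)` smeared with `f(x) g(y)`, where
`D₀(x) = D₀⁽⁺⁾(x) - D₀⁽⁺⁾(-x)`. -/
def pauliJordan (f g : Test) : ℂ := pauliJordanPlus f g - pauliJordanPlus g f

/-! ### Spinors and invariant tensors -/

/-- `σ^μ_{a b̄}`. -/
def pauli (μ : Fin 4) : Matrix (Fin 2) (Fin 2) ℂ :=
  ![!![1, 0; 0, 1], !![0, 1; 1, 0], !![0, -Complex.I; Complex.I, 0], !![1, 0; 0, -1]] μ

/-- The invariant tensor `ε^{ab} = - ε_{ab}`, `ε_{12} = 1`. -/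
def epsUp : Matrix (Fin 2) (Fin 2) ℂ := !![0, -1; 1, 0]

/-- The totally antisymmetric tensor on four indices, `ε_{0123} = 1` (both the `SU(4)` tensor and
the space-time tensor). -/
def eps4 (j k l m : Fin 4) : ℂ :=
  ((Int.sign ((((k : ℕ) : ℤ) - (j : ℕ)) * (((l : ℕ) : ℤ) - (j : ℕ)) * (((m : ℕ) : ℤ) - (j : ℕ)) *
    (((l : ℕ) : ℤ) - (k : ℕ)) * (((m : ℕ) : ℤ) - (k : ℕ)) * (((m : ℕ) : ℤ) - (l : ℕ))) : ℤ) : ℂ)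

/-- Kronecker symbol. -/
def kron (j k : Fin 4) : ℂ := if j = k then 1 else 0

/-- `σ^{μν}_{ab} = (i/4) (σ^μ_{a c̄} ε^{c̄ d̄} σ^ν_{b d̄} - (μ ↔ ν))`. -/
def pauli2 (μ ν : Fin 4) (a b : Fin 2) : ℂ :=
  Complex.I / 4 * ∑ c, ∑ d, epsUp c d * (pauli μ a c * pauli ν b d - pauli ν a c * pauli μ b d)

/-- The coefficients `t` of `𝓕_{μν} = ∑ t_{μν}^{cd} F_{cd}`, where
`𝓕^{μν} = -(1/2) σ^{μν}_{ab} F^{ab}`. -/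
def tensorCoeff (μ ν : Fin 4) (c d : Fin 2) : ℂ :=
  metric μ μ * metric ν ν * (-(1 / 2) * ∑ a, ∑ b, pauli2 μ ν a b * epsUp a c * epsUp b d)

/-! ### The fields of the multiplet and the constraints -/

/-- The Bosonic fields `φ_{jk}`, `φ*_{jk}`, `F_{ab}`, `F*_{āb̄}`. -/
inductive BoseField : Type
  | phi (j k : Fin 4)
  | phiBar (j k : Fin 4)
  | F (a b : Fin 2)
  | FBar (a b : Fin 2)
  deriving DecidableEq, Fintype

/-- The Fermionic fields `λ_{ja}`, `λ̄_{jā}`. -/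
inductive FermiField : Type
  | lam (j : Fin 4) (a : Fin 2)
  | lamBar (j : Fin 4) (a : Fin 2)
  deriving DecidableEq, Fintype

/-- The adjoint field. -/
def BoseField.bar : BoseField → BoseField
  | .phi j k => .phiBar j k
  | .phiBar j k => .phi j k
  | .F a b => .FBar a b
  | .FBar a b => .F a b

/-- The adjoint field. -/
def FermiField.bar : FermiField → FermiField
  | .lam j a => .lamBar j a
  | .lamBar j a => .lam j a

section Constraints

variable {W : Type*} [AddCommGroup W] [Module ℂ W]

/-- The derivative `∂_μ T` of a distribution: `(∂_μ T)(f) = - T(∂_μ f)`. -/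
def distDeriv (μ : Fin 4) (T : Test → W) : Test → W := fun f => -T (pd μ f)

/-- The wave operator `∂² = g^{μν} ∂_μ ∂_ν`. -/
def box (T : Test → W) : Test → W := fun f => ∑ μ, metric μ μ • distDeriv μ (distDeriv μ T) f

/-- The constraints on the Bosonic fields, for distributions with values in any complex vector
space (operators for the quantum fields, numbers for their commutators). -/
structure BoseConstraints (b : BoseField → Test → W) : Prop where
  phi_antisymm : ∀ j k f, b (.phi j k) f = -b (.phi k j) f
  phiBar_antisymm : ∀ j k f, b (.phiBar j k) f = -b (.phiBar k j) f
  phi_wave : ∀ j k f, box (b (.phi j k)) f = 0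
  phiBar_wave : ∀ j k f, box (b (.phiBar j k)) f = 0
  F_wave : ∀ a c f, box (b (.F a c)) f = 0
  FBar_wave : ∀ a c f, box (b (.FBar a c)) f = 0
  F_symm : ∀ a c f, b (.F a c) f = b (.F c a) f
  FBar_symm : ∀ a c f, b (.FBar a c) f = b (.FBar c a) f
  /-- `σ^μ_{a b̄} ε^{ac} ∂_μ F_{cd} = 0`. -/
  F_first_order : ∀ (e d : Fin 2) f,
    ∑ μ, ∑ a, ∑ c, (pauli μ a e * epsUp a c) • distDeriv μ (b (.F c d)) f = 0
  FBar_first_order : ∀ (e d : Fin 2) f,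
    ∑ μ, ∑ a, ∑ c, (conj (pauli μ a e) * epsUp a c) • distDeriv μ (b (.FBar c d)) f = 0
  /-- `ε_{jklm} φ_{lm} = 2 φ*_{jk}`. -/
  phi_reality : ∀ j k f, ∑ l, ∑ m, eps4 j k l m • b (.phi l m) f = (2 : ℂ) • b (.phiBar j k) f
  phiBar_reality : ∀ j k f,
    ∑ l, ∑ m, eps4 j k l m • b (.phiBar l m) f = (2 : ℂ) • b (.phi j k) f

/-- The constraints on the Fermionic fields: the massless Dirac (Weyl) equation
`σ^μ_{a b̄} ∂_μ λ̄_j^{b̄} = 0` with `λ̄_j^{b̄} = ε^{b̄ c̄} λ̄_{j c̄}`, and its adjoint. -/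
structure FermiConstraints (ψ : FermiField → Test → W) : Prop where
  lamBar_dirac : ∀ (j : Fin 4) (a : Fin 2) f,
    ∑ μ, ∑ b, ∑ c, (pauli μ a b * epsUp b c) • distDeriv μ (ψ (.lamBar j c)) f = 0
  lam_dirac : ∀ (j : Fin 4) (a : Fin 2) f,
    ∑ μ, ∑ b, ∑ c, (conj (pauli μ a b) * epsUp b c) • distDeriv μ (ψ (.lam j c)) f = 0

/-- The constraints on an antisymmetric tensor field: antisymmetry, `∂^μ F_{μν} = 0` and
`ε^{μναβ} ∂_β F_{μν} = 0`. -/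
structure TensorConstraints (T : Fin 4 → Fin 4 → Test → W) : Prop where
  antisymm : ∀ μ ν f, T μ ν f = -T ν μ f
  divergence : ∀ ν f, ∑ μ, metric μ μ • distDeriv μ (T μ ν) f = 0
  bianchi : ∀ α f, ∑ μ, ∑ ν, ∑ β, eps4 μ ν α β • distDeriv β (T μ ν) f = 0

end Constraints

/-! ### The multiplet -/

section Multiplet

variable {V : Type*} [AddCommGroup V] [Module ℂ V]

/-- The commutator. -/
def comm (A B : Module.End ℂ V) : Module.End ℂ V := A * B - B * A

/-- The anticommutator. -/
def acomm (A B : Module.End ℂ V) : Module.End ℂ V := A * B + B * A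

/-- `B` is the adjoint of `A` with respect to the form `⟨·,·⟩`. -/
def IsAdj (form : V →ₗ⋆[ℂ] V →ₗ[ℂ] ℂ) (A B : Module.End ℂ V) : Prop :=
  ∀ u v, form (A u) v = form u (B v)

/-- The `N = 4` multiplet without central charges, on an invariant domain `V` of states carrying a
sesquilinear form: the fields `φ_{jk}`, `F_{ab}`, `λ_{ja}` (operator-valued distributions) with
their adjoints, the supercharges `Q_{ja}` and `Q̄_{jā}`, the action of the supercharges on the
fields, the constraints, and the requirement that the fields are free, i.e. that the graded
commutator of any two fields is a multiple of the identity. No continuity of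
`f ↦ ⟨u, φ(f) v⟩` is demanded. -/
structure Multiplet (form : V →ₗ⋆[ℂ] V →ₗ[ℂ] ℂ) where
  bose : BoseField → Test →ₗ[ℂ] Module.End ℂ V
  fermi : FermiField → Test →ₗ[ℂ] Module.End ℂ V
  Q : Fin 4 → Fin 2 → Module.End ℂ V
  Qbar : Fin 4 → Fin 2 → Module.End ℂ V
  bose_adj : ∀ I f, IsAdj form (bose I f) (bose I.bar (testConj f))
  fermi_adj : ∀ I f, IsAdj form (fermi I f) (fermi I.bar (testConj f))
  Q_adj : ∀ j a, IsAdj form (Q j a) (Qbar j a)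
  /-- `i [Q_{ja}, φ_{kl}] = ε_{jklm} λ_{ma}` -/
  Q_phi : ∀ j a k l f,
    Complex.I • comm (Q j a) (bose (.phi k l) f) = ∑ m, eps4 j k l m • fermi (.lam m a) f
  /-- `i [Q̄_{jā}, φ_{kl}] = δ_{jk} λ̄_{lā} - δ_{jl} λ̄_{kā}` -/
  Qbar_phi : ∀ j a k l f,
    Complex.I • comm (Qbar j a) (bose (.phi k l) f)
      = kron j k • fermi (.lamBar l a) f - kron j l • fermi (.lamBar k a) f
  /-- `{Q_{ja}, λ_{kb}} = δ_{jk} F_{ab}` -/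
  Q_lam : ∀ j a k b f, acomm (Q j a) (fermi (.lam k b) f) = kron j k • bose (.F a b) f
  /-- `{Q_{ja}, λ̄_{kb̄}} = 2 σ^μ_{ab̄} ∂_μ φ_{jk}` -/
  Q_lamBar : ∀ j a k b f,
    acomm (Q j a) (fermi (.lamBar k b) f)
      = ∑ μ, (2 * pauli μ a b) • distDeriv μ (bose (.phi j k)) f
  /-- `[Q_{ja}, F_{bc}] = 0` -/
  Q_F : ∀ j a b c f, comm (Q j a) (bose (.F b c) f) = 0
  /-- `[Q̄_{jā}, F_{bc}] = - 2 i σ^μ_{cā} ∂_μ λ_{jb}` -/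
  Qbar_F : ∀ j a b c f,
    comm (Qbar j a) (bose (.F b c) f)
      = ∑ μ, (-2 * Complex.I * pauli μ c a) • distDeriv μ (fermi (.lam j b)) f
  bose_constraints : BoseConstraints (fun I f => bose I f)
  fermi_constraints : FermiConstraints (fun I f => fermi I f)
  free_bose : ∀ I J f g, ∃ c : ℂ, comm (bose I f) (bose J g) = c • 1
  free_fermi : ∀ I J f g, ∃ c : ℂ, acomm (fermi I f) (fermi J g) = c • 1
  free_mixed : ∀ I J f g, ∃ c : ℂ, comm (bose I f) (fermi J g) = c • 1

/-- The Hermitian tensor field `F_{μν} = (i/2) (𝓕_{μν} - 𝓕*_{μν})`, where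
`𝓕^{μν} = -(1/2) σ^{μν}_{ab} F^{ab}`. -/
def Multiplet.tensorF {form : V →ₗ⋆[ℂ] V →ₗ[ℂ] ℂ} (M : Multiplet form) (μ ν : Fin 4) (f : Test) :
    Module.End ℂ V :=
  (Complex.I / 2) •
    ((∑ c, ∑ d, tensorCoeff μ ν c d • M.bose (.F c d) f) -
      ∑ c, ∑ d, conj (tensorCoeff μ ν c d) • M.bose (.FBar c d) f)

end Multiplet

/-! ### The causal (anti)commutators

Every kernel is written for a bilinear kernel `D`, to be read as `D(x - y)` smeared with
`f(x) g(y)`. The derivatives act on `x`. The causal (anti)commutators are obtained for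
`D = pauliJordan`, the corresponding `2`-point functions for `D = pauliJordanPlus`. -/

/-- `(∂_μ D)(x - y)`, smeared. -/
def dKer (D : Test → Test → ℂ) (μ : Fin 4) (f g : Test) : ℂ := distDeriv μ (fun h => D h g) f

/-- `(∂_μ ∂_ν D)(x - y)`, smeared. -/
def ddKer (D : Test → Test → ℂ) (μ ν : Fin 4) (f g : Test) : ℂ :=
  distDeriv μ (distDeriv ν (fun h => D h g)) f

/-- `2 i (σ^μ_{ac̄} σ^ν_{bd̄} + σ^μ_{ad̄} σ^ν_{bc̄}) ∂_μ ∂_ν D`. -/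
def spinorKer (D : Test → Test → ℂ) (a b c d : Fin 2) (f g : Test) : ℂ :=
  ∑ μ, ∑ ν, 2 * Complex.I * (pauli μ a c * pauli ν b d + pauli μ a d * pauli ν b c) *
    ddKer D μ ν f g

/-- `-(i/2) (g_{μρ} ∂_ν ∂_σ - g_{νρ} ∂_μ ∂_σ + g_{νσ} ∂_μ ∂_ρ - g_{μσ} ∂_ν ∂_ρ) D`. -/
def tensorKer (D : Test → Test → ℂ) (μ ν ρ σ : Fin 4) (f g : Test) : ℂ :=
  -(Complex.I / 2) *
    (metric μ ρ * ddKer D ν σ f g - metric ν ρ * ddKer D μ σ f g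
      + metric ν σ * ddKer D μ ρ f g - metric μ σ * ddKer D ν ρ f g)

/-- The table of the commutators of the Bosonic fields; the ones not listed are zero. The
entries `[φ, φ]` and `[φ*, φ*]` are forced by `[φ, φ*]` and `2 φ*_{jk} = ε_{jklm} φ_{lm}`. -/
def boseKer (D : Test → Test → ℂ) : BoseField → BoseField → Test → Test → ℂ
  | .phi j k, .phiBar l m => fun f g =>
      -Complex.I * (kron j l * kron k m - kron j m * kron k l) * D f g
  | .phiBar j k, .phi l m => fun f g =>
      -Complex.I * (kron j l * kron k m - kron j m * kron k l) * D f g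
  | .phi j k, .phi l m => fun f g => -Complex.I * eps4 j k l m * D f g
  | .phiBar j k, .phiBar l m => fun f g => -Complex.I * eps4 j k l m * D f g
  | .F a b, .FBar c d => spinorKer D a b c d
  | .FBar c d, .F a b => spinorKer D a b c d
  | _, _ => fun _ _ => 0

/-- The table of the anticommutators of the Fermionic fields; the ones not listed are zero. -/
def fermiKer (D : Test → Test → ℂ) : FermiField → FermiField → Test → Test → ℂ
  | .lam j a, .lamBar k b => fun f g => ∑ μ, 2 * kron j k * pauli μ a b * dKer D μ f g
  | .lamBar k b, .lam j a => fun f g => ∑ μ, 2 * kron j k * pauli μ a b * dKer D μ f g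
  | _, _ => fun _ _ => 0

/-- The positivity condition for a system `w` of `2`-point functions
`w I J f g = ⟨Ω, X_I(f) X_J(g) Ω⟩`: every one-particle state `∑ X_I(f_I) Ω` has non-negative
norm squared. -/
def Positivity {ι : Type} [Fintype ι] (bar : ι → ι) (w : ι → ι → Test → Test → ℂ) : Prop :=
  ∀ f : ι → Test,
    0 ≤ (∑ I, ∑ J, w (bar I) J (testConj (f I)) (f J)).re ∧
      (∑ I, ∑ J, w (bar I) J (testConj (f I)) (f J)).im = 0

end N4

end

/-! Three properties of $D_0$ carry all the algebra: it is a bilinear translation invariant kernel,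
it solves the wave equation (`IsWaveKernel`), and it is odd under exchange of its arguments.
Integrability on the cone makes the momentum integral well defined; on the light cone, derivatives
become multiplication by $p_\mu$.

The (anti)commutators of a multiplet follow from graded Jacobi identities. Commuting a Bose field
with the number $\{\psi,\psi\}$ shows that Bose and Fermi fields commute (`comm_bose_fermi`). Hence
$\{\psi,[q,B]\}=[\{q,\psi\},B]$ for a supercharge $q$. Writing $\lambda$ or $\bar\lambda$ as
$i[q,\phi]$ turns anticommutators of spinors into commutators of Bose fields:
$\{\lambda,\lambda\}=0$, $[F,\phi]=0$, and $\{\lambda,\bar\lambda\}$ becomes a derivative of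
$[\phi^*,\phi]$. Writing $F$ or $F^*$ as $\{q,\psi\}$ gives $[F,F]=0$ and reduces $[F,F^*]$ to
$\{\lambda,\bar\lambda\}$. The relations involving $\bar Q$ that are not assumed, and the remaining
zeros, come from uniqueness of adjoints under a nondegenerate form.

The spinor identities all rest on `IsWaveTensor.pauli_exchange`: for symmetric trace-free $T$,
$\sigma^\mu_{a\bar c}\sigma^\nu_{b\bar d}T_{\mu\nu}$ is symmetric in $\bar c,\bar d$. The
first-order constraints are its $\epsilon$-contractions. The equivalence in (2) holds because
$F_{ab}\mapsto F_{\mu\nu}$ is inverted by `recoverCoeff`, which returns $F_{ab}$ and annihilates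
$F^*$.

Covariance is unitarity for the Kronecker deltas and $\det U=1$ for $\epsilon$. Positivity is
checked at each momentum: $p_\mu\sigma^\mu$ has the form $uu^*$ on the cone, which makes the spinor
forms sums of squares; the scalar form is half a sum of squares; the tensor form is minus the
Minkowski square of a vector orthogonal to $p$. -/

namespace N4

/-! ### Fourier transforms on the light cone and the Pauli–Jordan kernel. -/

section

open MeasureTheory FourierTransform

/-- The momentum `p_μ` (lower index) on the forward light cone. -/
noncomputable def coneMomentum (k : EuclideanSpace ℝ (Fin 3)) : Fin 4 → ℝ :=
  Fin.cons ‖k‖ (fun i => -k i)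

lemma coneDot_eq_sum (k : EuclideanSpace ℝ (Fin 3)) (x : Spacetime) :
    coneDot k x = ∑ μ, coneMomentum k μ * x μ := by
  simp [coneDot, coneMomentum, Fin.sum_univ_succ]
  ring

/-- The point at which the Fourier transform has to be evaluated to get `coneFourier`. -/
noncomputable def coneFrequency (s : ℝ) (k : EuclideanSpace ℝ (Fin 3)) : Spacetime :=
  WithLp.toLp 2 fun μ => -(s / (2 * Real.pi)) * coneMomentum k μ

/-- The Fourier transform of Schwartz functions carries the phase $e^{-2\pi i\langle x,\xi\rangle}$,
which accounts for the factor $-s/(2\pi)$ in `coneFrequency`. Decay, continuity and the derivative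
rule on the cone are inherited through this identity. -/
lemma coneFourier_eq_fourier (s : ℝ) (f : Test) (k : EuclideanSpace ℝ (Fin 3)) :
    coneFourier s f k = 𝓕 f (coneFrequency s k) := by
  rw [SchwartzMap.fourier_coe, Real.fourier_eq', coneFourier]
  refine integral_congr_ae (.of_forall fun x => ?_)
  simp only [smul_eq_mul]
  congr 2
  rw [coneDot_eq_sum, mul_comm]
  congr 2
  simp only [PiLp.inner_apply, coneFrequency, Finset.mul_sum]
  refine Finset.sum_congr rfl fun μ _ => ?_
  simp
  field_simp [Real.pi_ne_zero]

lemma continuous_coneMomentum (μ : Fin 4) : Continuous fun k => coneMomentum k μ := by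
  refine Fin.cases ?_ (fun i => ?_) μ <;> simp only [coneMomentum, Fin.cons_zero, Fin.cons_succ] <;>
    fun_prop

lemma continuous_coneFourier (s : ℝ) (f : Test) : Continuous (coneFourier s f) := by
  have h : coneFourier s f = fun k => 𝓕 f (coneFrequency s k) :=
    funext fun k => coneFourier_eq_fourier s f k
  rw [h]
  have h2 : Continuous (coneFrequency s) := by
    refine (PiLp.continuous_toLp 2 _).comp (continuous_pi fun μ => ?_)
    exact continuous_const.mul (continuous_coneMomentum μ)
  exact (𝓕 f).continuous.comp h2

lemma coneFourier_pd (s : ℝ) (f : Test) (μ : Fin 4) (k : EuclideanSpace ℝ (Fin 3)) :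
    coneFourier s (pd μ f) k = -(Complex.I * s * coneMomentum k μ) * coneFourier s f k := by
  rw [coneFourier_eq_fourier, coneFourier_eq_fourier, pd, SchwartzMap.fourier_lineDerivOp_eq]
  have : (inner ℝ · (EuclideanSpace.single μ (1 : ℝ) : Spacetime)).HasTemperateGrowth :=
    ((innerSL ℝ).flip _).hasTemperateGrowth
  rw [_root_.smul_apply, SchwartzMap.smulLeftCLM_apply_apply this]
  have h2 : inner ℝ (coneFrequency s k) (EuclideanSpace.single μ (1 : ℝ) : Spacetime) =
      -(s / (2 * Real.pi)) * coneMomentum k μ := by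
    simp [coneFrequency, EuclideanSpace.inner_single_right]
  rw [h2]
  have : (Real.pi : ℂ) ≠ 0 := by exact_mod_cast Real.pi_ne_zero
  simp only [smul_eq_mul, Complex.real_smul]
  push_cast
  field_simp

lemma coneFourier_add (s : ℝ) (f g : Test) (k : EuclideanSpace ℝ (Fin 3)) :
    coneFourier s (f + g) k = coneFourier s f k + coneFourier s g k := by
  simp [coneFourier_eq_fourier, FourierTransform.fourier_add]

lemma coneFourier_smul (s : ℝ) (c : ℂ) (f : Test) (k : EuclideanSpace ℝ (Fin 3)) :
    coneFourier s (c • f) k = c * coneFourier s f k := by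
  simp [coneFourier_eq_fourier, FourierTransform.fourier_smul]

/-- Conjugation reverses the phase. This makes $D_0^{(+)}(\bar f,g)$ a positive weight, up to the
factor $i$, against $\overline{\hat f}\,\hat g$. -/
lemma coneFourier_testConj (s : ℝ) (f : Test) (k : EuclideanSpace ℝ (Fin 3)) :
    coneFourier (-s) (testConj f) k = conj (coneFourier s f k) := by
  rw [coneFourier, coneFourier, ← integral_conj]
  refine integral_congr_ae (.of_forall fun x => ?_)
  simp [testConj, ← Complex.exp_conj]

lemma coneMomentum_sq (k : EuclideanSpace ℝ (Fin 3)) :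
    coneMomentum k 0 ^ 2 = coneMomentum k 1 ^ 2 + coneMomentum k 2 ^ 2 + coneMomentum k 3 ^ 2 := by
  have h := EuclideanSpace.real_norm_sq_eq k
  rw [Fin.sum_univ_three] at h
  have h1 : coneMomentum k 1 = -k 0 := rfl
  have h2 : coneMomentum k 2 = -k 1 := rfl
  have h3 : coneMomentum k 3 = -k 2 := rfl
  have h0 : coneMomentum k 0 = ‖k‖ := rfl
  rw [h0, h1, h2, h3, h]; ring

/-- On the cone the squared Euclidean length of $(p_\mu)$ is $2\|k\|^2$, so Schwartz decay in four
dimensions restricts to decay in $k$. The zeroth and second seminorms suffice. -/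
lemma norm_coneFourier_le (s : ℝ) (hs : s ^ 2 = 1) (f : Test) :
    ∃ C : ℝ, 0 ≤ C ∧ ∀ k, ‖coneFourier s f k‖ ≤ C * (1 + ‖k‖ ^ 2)⁻¹ := by
  obtain ⟨A, hA, hA'⟩ := (𝓕 f).decay 0 0
  obtain ⟨B, hB, hB'⟩ := (𝓕 f).decay 2 0
  refine ⟨A + (2 * Real.pi ^ 2) * B, by positivity, fun k => ?_⟩
  rw [coneFourier_eq_fourier, ← div_eq_mul_inv, le_div_iff₀ (by positivity)]
  have h1 := hA' (coneFrequency s k)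
  have h2 := hB' (coneFrequency s k)
  simp only [pow_zero, one_mul, norm_iteratedFDeriv_zero] at h1 h2
  have h3 : ‖coneFrequency s k‖ ^ 2 = ‖k‖ ^ 2 / (2 * Real.pi ^ 2) := by
    rw [EuclideanSpace.real_norm_sq_eq, Fin.sum_univ_four]
    simp only [coneFrequency, PiLp.toLp_apply, mul_pow, neg_sq, div_pow, hs, ← mul_add]
    rw [add_assoc, add_assoc, ← add_assoc (coneMomentum k 1 ^ 2), ← coneMomentum_sq]
    change _ * (‖k‖ ^ 2 + ‖k‖ ^ 2) = _
    field_simp [Real.pi_ne_zero]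
    ring
  rw [h3] at h2
  have h4 : ‖k‖ ^ 2 * ‖(𝓕 f) (coneFrequency s k)‖ ≤ (2 * Real.pi ^ 2) * B := by
    have := mul_le_mul_of_nonneg_left h2 (show (0 : ℝ) ≤ 2 * Real.pi ^ 2 by positivity)
    refine le_of_eq_of_le ?_ this
    field_simp [Real.pi_ne_zero]
  linarith

lemma integrable_inv_norm_mul_inv_sq :
    Integrable fun k : EuclideanSpace ℝ (Fin 3) => ‖k‖⁻¹ * ((1 + ‖k‖ ^ 2)⁻¹) ^ 2 := by
  have := integrable_fun_norm_addHaar (E := EuclideanSpace ℝ (Fin 3)) volume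
    (f := fun r : ℝ => r⁻¹ * ((1 + r ^ 2)⁻¹) ^ 2)
  rw [this]
  refine (integrable_inv_one_add_sq.integrableOn (s := Set.Ioi 0)).mono' ?_ ?_
  · exact (by fun_prop : Measurable _).aestronglyMeasurable
  · refine (ae_restrict_iff' measurableSet_Ioi).2 (.of_forall fun r hr => ?_)
    have hr : 0 < r := hr
    simp only [finrank_euclideanSpace, Fintype.card_fin, smul_eq_mul]
    rw [Real.norm_of_nonneg (by positivity)]
    -- In polar coordinates the Jacobian $r^2$ absorbs the singularity $r^{-1}$, and the rest is
    -- bounded through $r\le 1+r^2$.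
    have : r ^ (3 - 1) * (r⁻¹ * (1 + r ^ 2)⁻¹ ^ 2) = (r / (1 + r ^ 2)) * (1 + r ^ 2)⁻¹ := by
      field_simp
    rw [this]
    refine mul_le_of_le_one_left (by positivity) ?_
    rw [div_le_one (by positivity)]
    nlinarith [sq_nonneg (r - 1)]

lemma integrable_pauliJordanPlus (f g : Test) :
    Integrable fun k : EuclideanSpace ℝ (Fin 3) =>
      (1 / (2 * (‖k‖ : ℂ))) * coneFourier (-1) f k * coneFourier 1 g k := by
  obtain ⟨A, hA, hA'⟩ := norm_coneFourier_le (-1) (by norm_num) f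
  obtain ⟨B, hB, hB'⟩ := norm_coneFourier_le 1 (by norm_num) g
  refine (integrable_inv_norm_mul_inv_sq.const_mul (A * B)).mono' ?_ (.of_forall fun k => ?_)
  · refine Measurable.aestronglyMeasurable ?_
    have h1 := (continuous_coneFourier (-1) f).measurable
    have h2 := (continuous_coneFourier 1 g).measurable
    fun_prop
  · rw [norm_mul, norm_mul]
    have h0 : ‖1 / (2 * (‖k‖ : ℂ))‖ ≤ ‖k‖⁻¹ := by
      rw [norm_div, norm_mul, Complex.norm_real, norm_norm, norm_one, Complex.norm_ofNat, one_div,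
        mul_inv]
      exact mul_le_of_le_one_left (by positivity) (by norm_num)
    calc _ ≤ ‖k‖⁻¹ * (A * (1 + ‖k‖ ^ 2)⁻¹) * (B * (1 + ‖k‖ ^ 2)⁻¹) := by
          gcongr
          · exact hA' k
          · exact hB' k
      _ = _ := by ring

/-- The properties shared by the Pauli-Jordan distribution and its positive frequency part:
bilinear, translation invariant, and solving the wave equation. -/
structure IsWaveKernel (D : Test → Test → ℂ) : Prop where
  add_left : ∀ f f' g, D (f + f') g = D f g + D f' g
  smul_left : ∀ (c : ℂ) f g, D (c • f) g = c * D f g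
  add_right : ∀ f g g', D f (g + g') = D f g + D f g'
  smul_right : ∀ (c : ℂ) f g, D f (c • g) = c * D f g
  translation : ∀ μ f g, D f (pd μ g) = -D (pd μ f) g
  wave : ∀ f g, D (pd 0 (pd 0 f)) g =
    D (pd 1 (pd 1 f)) g + D (pd 2 (pd 2 f)) g + D (pd 3 (pd 3 f)) g

lemma isWaveKernel_pauliJordanPlus : IsWaveKernel pauliJordanPlus where
  add_left f f' g := by
    rw [pauliJordanPlus, pauliJordanPlus, pauliJordanPlus, ← mul_add,
      ← integral_add (integrable_pauliJordanPlus f g) (integrable_pauliJordanPlus f' g)]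
    simp only [coneFourier_add, mul_add, add_mul]
  smul_left c f g := by
    rw [pauliJordanPlus, pauliJordanPlus, mul_left_comm, ← integral_const_mul c]
    simp only [coneFourier_smul]
    congr 2; funext k; ring
  add_right f g g' := by
    rw [pauliJordanPlus, pauliJordanPlus, pauliJordanPlus, ← mul_add,
      ← integral_add (integrable_pauliJordanPlus f g) (integrable_pauliJordanPlus f g')]
    simp only [coneFourier_add, mul_add]
  smul_right c f g := by
    rw [pauliJordanPlus, pauliJordanPlus, mul_left_comm, ← integral_const_mul c]
    simp only [coneFourier_smul]
    congr 2; funext k; ring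
  translation μ f g := by
    rw [pauliJordanPlus, pauliJordanPlus, ← mul_neg, ← integral_neg]
    simp only [coneFourier_pd]
    congr 2; funext k; push_cast; ring
  wave f g := by
    have h1 := integrable_pauliJordanPlus (pd 1 (pd 1 f)) g
    have h2 := integrable_pauliJordanPlus (pd 2 (pd 2 f)) g
    have h3 := integrable_pauliJordanPlus (pd 3 (pd 3 f)) g
    rw [pauliJordanPlus, pauliJordanPlus, pauliJordanPlus, pauliJordanPlus, ← mul_add, ← mul_add,
      ← integral_add h1 h2]
    have h := integral_add (h1.add h2) h3
    simp only [Pi.add_apply] at h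
    rw [← h]
    clear h h1 h2 h3
    congr 1
    refine integral_congr_ae (.of_forall fun k => ?_)
    simp only [coneFourier_pd]
    -- The wave equation is the mass-shell condition $p^2=0$ under the integral.
    have h : (coneMomentum k 0 : ℂ) ^ 2 =
      coneMomentum k 1 ^ 2 + coneMomentum k 2 ^ 2 + coneMomentum k 3 ^ 2 := by
      exact_mod_cast coneMomentum_sq k
    push_cast
    linear_combination (Complex.I ^ 2 * (1 / (2 * (‖k‖ : ℂ))) * coneFourier (-1) f k *
      coneFourier 1 g k) * h

namespace IsWaveKernel

variable {D E : Test → Test → ℂ}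

lemma swap (hD : IsWaveKernel D) : IsWaveKernel fun f g => D g f where
  add_left f f' g := hD.add_right g f f'
  smul_left c f g := hD.smul_right c g f
  add_right f g g' := hD.add_left g g' f
  smul_right c f g := hD.smul_left c g f
  translation μ f g := by rw [hD.translation, neg_neg]
  wave f g := by
    simp only [hD.translation, neg_neg]
    exact hD.wave g f

lemma sub (hD : IsWaveKernel D) (hE : IsWaveKernel E) :
    IsWaveKernel fun f g => D f g - E f g where
  add_left f f' g := by rw [hD.add_left, hE.add_left]; ring
  smul_left c f g := by rw [hD.smul_left, hE.smul_left]; ring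
  add_right f g g' := by rw [hD.add_right, hE.add_right]; ring
  smul_right c f g := by rw [hD.smul_right, hE.smul_right]; ring
  translation μ f g := by rw [hD.translation, hE.translation]; ring
  wave f g := by rw [hD.wave, hE.wave]; ring

end IsWaveKernel

lemma isWaveKernel_pauliJordan : IsWaveKernel pauliJordan :=
  isWaveKernel_pauliJordanPlus.sub isWaveKernel_pauliJordanPlus.swap

lemma pauliJordan_swap (f g : Test) : pauliJordan g f = -pauliJordan f g := by
  simp [pauliJordan]

/-- Symmetry of the second Fréchet derivative of a smooth function. -/
lemma pd_comm (μ ν : Fin 4) (f : Test) : pd μ (pd ν f) = pd ν (pd μ f) := by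
  ext x
  have h (v w : Spacetime) : LineDeriv.lineDerivOp v (LineDeriv.lineDerivOp w f : Test) x =
      fderiv ℝ (fderiv ℝ f) x v w := by
    change fderiv ℝ (fun y => fderiv ℝ f y w) x v = _
    have hd : DifferentiableAt ℝ (fderiv ℝ f) x :=
      ((f.smooth 2).fderiv_right (m := 1) le_rfl).differentiable one_ne_zero x
    rw [fderiv_clm_apply hd (differentiableAt_const w)]
    simp
  rw [pd, pd, pd, pd, h, h]
  exact (((f.smooth 2).contDiffAt).isSymmSndFDerivAt (by simp)).eq _ _

end

/-! ### Spinor identities for second derivatives of a wave kernel. -/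

/-- A symmetric tensor whose Minkowski trace vanishes. -/
structure IsWaveTensor (T : Fin 4 → Fin 4 → ℂ) : Prop where
  symm : ∀ μ ν, T μ ν = T ν μ
  trace : T 0 0 = T 1 1 + T 2 2 + T 3 3

/-- For symmetric $T$ the part antisymmetric in $c,d$ is also antisymmetric in $a,b$, hence a
multiple of $\epsilon_{ab}\epsilon_{cd}$ times the Minkowski trace of $T$, which vanishes. -/
lemma IsWaveTensor.pauli_exchange {T : Fin 4 → Fin 4 → ℂ} (hT : IsWaveTensor T)
    (a b c d : Fin 2) :
    ∑ μ, ∑ ν, pauli μ a c * pauli ν b d * T μ ν = ∑ μ, ∑ ν, pauli μ a d * pauli ν b c * T μ ν := by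
  have h0 := hT.trace
  have h1 := hT.symm 1 0
  have h2 := hT.symm 2 0
  have h3 := hT.symm 3 0
  have h4 := hT.symm 2 1
  have h5 := hT.symm 3 1
  have h6 := hT.symm 3 2
  fin_cases a <;> fin_cases b <;> fin_cases c <;> fin_cases d <;>
    simp [pauli, Fin.sum_univ_four, h0, h1, h2, h3, h4, h5, h6] <;>
    ring

lemma IsWaveTensor.pauli_swap {T : Fin 4 → Fin 4 → ℂ} (hT : IsWaveTensor T) (a b c d : Fin 2) :
    ∑ μ, ∑ ν, pauli μ a c * pauli ν b d * T μ ν = ∑ μ, ∑ ν, pauli μ b d * pauli ν a c * T μ ν := by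
  rw [Finset.sum_comm]
  refine Finset.sum_congr rfl fun ν _ => Finset.sum_congr rfl fun μ _ => ?_
  rw [hT.symm μ ν]; ring

/-- The $\epsilon$-contraction over the undotted indices; together with its dotted counterpart it
yields the Weyl equations and the first-order constraints on $F$ and $F^*$. -/
lemma IsWaveTensor.pauli_eps_left {T : Fin 4 → Fin 4 → ℂ} (hT : IsWaveTensor T) (e d : Fin 2) :
    ∑ μ, ∑ ν, (pauli μ 0 e * pauli ν 1 d - pauli μ 1 e * pauli ν 0 d) * T μ ν = 0 := by
  simp only [sub_mul, Finset.sum_sub_distrib]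
  rw [hT.pauli_exchange 0 1 e d, hT.pauli_swap, sub_self]

lemma IsWaveTensor.pauli_eps_right {T : Fin 4 → Fin 4 → ℂ} (hT : IsWaveTensor T) (e d : Fin 2) :
    ∑ μ, ∑ ν, (pauli μ e 0 * pauli ν d 1 - pauli μ e 1 * pauli ν d 0) * T μ ν = 0 := by
  simp only [sub_mul, Finset.sum_sub_distrib]
  rw [hT.pauli_exchange e d 0 1, sub_self]

lemma conj_pauli (μ : Fin 4) (a b : Fin 2) : conj (pauli μ a b) = pauli μ b a := by
  fin_cases μ <;> fin_cases a <;> fin_cases b <;> simp [pauli]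

lemma dKer_apply (D : Test → Test → ℂ) (μ : Fin 4) (f g : Test) :
    dKer D μ f g = -D (pd μ f) g := rfl

lemma ddKer_apply (D : Test → Test → ℂ) (μ ν : Fin 4) (f g : Test) :
    ddKer D μ ν f g = D (pd ν (pd μ f)) g := neg_neg _

lemma pd_pd_comm (μ ν ρ : Fin 4) (f : Test) : pd μ (pd ν (pd ρ f)) = pd ν (pd ρ (pd μ f)) := by
  rw [pd_comm μ, pd_comm μ]

/-- A complex valued distribution solving the wave equation. -/
def IsWaveSolution (T : Test → ℂ) : Prop :=
  ∀ f, T (pd 0 (pd 0 f)) = T (pd 1 (pd 1 f)) + T (pd 2 (pd 2 f)) + T (pd 3 (pd 3 f))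

lemma IsWaveSolution.box_eq_zero {T : Test → ℂ} (hT : IsWaveSolution T) (f : Test) :
    box T f = 0 := by
  simp [box, distDeriv, metric, Fin.sum_univ_four, hT f]
  ring

namespace IsWaveKernel

variable {D : Test → Test → ℂ}

lemma isWaveSolution (hD : IsWaveKernel D) (g : Test) : IsWaveSolution fun f => D f g :=
  fun f => hD.wave f g

lemma isWaveSolution_dd (hD : IsWaveKernel D) (μ ν : Fin 4) (g : Test) :
    IsWaveSolution fun f => ddKer D μ ν f g := by
  intro f
  simp only [ddKer_apply]
  have h (ρ : Fin 4) : pd ν (pd μ (pd ρ (pd ρ f))) = pd ρ (pd ρ (pd ν (pd μ f))) := by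
    rw [pd_pd_comm μ, pd_pd_comm ν]
  simp only [h]
  exact hD.wave _ g

lemma isWaveTensor (hD : IsWaveKernel D) (f g : Test) :
    IsWaveTensor fun μ ν => ddKer D μ ν f g where
  symm μ ν := by rw [ddKer_apply, ddKer_apply, pd_comm]
  trace := by simp only [ddKer_apply]; exact hD.wave f g

/-- Up to sign these are third derivatives of $D$ with the index $\rho$ as a spectator, so the
second-order identities apply to the other two. -/
lemma isWaveTensor_ddd (hD : IsWaveKernel D) (ρ : Fin 4) (f g : Test) :
    IsWaveTensor fun μ ν => ddKer D ν ρ (pd μ f) g where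
  symm μ ν := by simp only [ddKer_apply]; rw [pd_comm ν μ]
  trace := by
    simp only [ddKer_apply, pd_pd_comm ρ]
    exact hD.wave _ g

end IsWaveKernel

lemma IsWaveSolution.const_mul {T : Test → ℂ} (hT : IsWaveSolution T) (c : ℂ) :
    IsWaveSolution fun f => c * T f := by
  intro f; simp only; rw [hT f]; ring

lemma isWaveSolution_zero : IsWaveSolution fun _ => 0 := fun _ => by simp

lemma isWaveSolution_sum {ι : Type*} (s : Finset ι) {T : ι → Test → ℂ}
    (hT : ∀ i, IsWaveSolution (T i)) : IsWaveSolution fun f => ∑ i ∈ s, T i f := by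
  intro f
  simp only [← Finset.sum_add_distrib]
  exact Finset.sum_congr rfl fun i _ => hT i f

lemma IsWaveKernel.isWaveSolution_spinorKer {D : Test → Test → ℂ} (hD : IsWaveKernel D)
    (a b c d : Fin 2) (g : Test) : IsWaveSolution fun f => spinorKer D a b c d f g :=
  isWaveSolution_sum _ fun _ => isWaveSolution_sum _ fun _ => (hD.isWaveSolution_dd _ _ g).const_mul _

lemma IsWaveKernel.isWaveSolution_boseKer {D : Test → Test → ℂ} (hD : IsWaveKernel D)
    (I J : BoseField) (g : Test) : IsWaveSolution fun f => boseKer D I J f g := by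
  cases I <;> cases J <;>
    first
    | exact isWaveSolution_zero
    | exact (hD.isWaveSolution g).const_mul _
    | exact hD.isWaveSolution_spinorKer _ _ _ _ g

/-! ### Contractions of the internal tensors and exchange of the two arguments. -/

lemma kron_comm (j k : Fin 4) : kron j k = kron k j := by simp [kron, eq_comm]

lemma eps4_contract (j k p q : Fin 4) :
    ∑ l, ∑ m, eps4 j k l m * eps4 l m p q = 2 * (kron j p * kron k q - kron j q * kron k p) := by
  -- The identity is stated over ℤ, where it is a decidable finite check, and then cast to ℂ.
  have h : ∀ j k p q : Fin 4, ∑ l : Fin 4, ∑ m : Fin 4,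
      Int.sign ((((k : ℕ) : ℤ) - (j : ℕ)) * (((l : ℕ) : ℤ) - (j : ℕ)) * (((m : ℕ) : ℤ) - (j : ℕ)) *
        (((l : ℕ) : ℤ) - (k : ℕ)) * (((m : ℕ) : ℤ) - (k : ℕ)) * (((m : ℕ) : ℤ) - (l : ℕ))) *
      Int.sign ((((m : ℕ) : ℤ) - (l : ℕ)) * (((p : ℕ) : ℤ) - (l : ℕ)) * (((q : ℕ) : ℤ) - (l : ℕ)) *
        (((p : ℕ) : ℤ) - (m : ℕ)) * (((q : ℕ) : ℤ) - (m : ℕ)) * (((q : ℕ) : ℤ) - (p : ℕ))) =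
      2 * ((if j = p then 1 else 0) * (if k = q then 1 else 0) -
        (if j = q then 1 else 0) * (if k = p then 1 else 0)) := by
    decide +kernel
  have := h j k p q
  simp only [eps4, kron]
  exact_mod_cast this

lemma eps4_pair_symm (j k l m : Fin 4) : eps4 j k l m = eps4 l m j k := by
  have h : ∀ j k l m : Fin 4,
      Int.sign ((((k : ℕ) : ℤ) - (j : ℕ)) * (((l : ℕ) : ℤ) - (j : ℕ)) * (((m : ℕ) : ℤ) - (j : ℕ)) *
        (((l : ℕ) : ℤ) - (k : ℕ)) * (((m : ℕ) : ℤ) - (k : ℕ)) * (((m : ℕ) : ℤ) - (l : ℕ))) =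
      Int.sign ((((m : ℕ) : ℤ) - (l : ℕ)) * (((j : ℕ) : ℤ) - (l : ℕ)) * (((k : ℕ) : ℤ) - (l : ℕ)) *
        (((j : ℕ) : ℤ) - (m : ℕ)) * (((k : ℕ) : ℤ) - (m : ℕ)) * (((k : ℕ) : ℤ) - (j : ℕ))) := by
    decide +kernel
  simp only [eps4, h j k l m]

lemma eps4_swap_left (j k l m : Fin 4) : eps4 j k l m = -eps4 k j l m := by
  rw [eps4, eps4, ← Int.cast_neg, ← Int.sign_neg]
  congr 2; ring

lemma eps4_swap_right (j k l m : Fin 4) : eps4 j k l m = -eps4 j k m l := by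
  rw [eps4, eps4, ← Int.cast_neg, ← Int.sign_neg]
  congr 2; ring

lemma sum_kron_left (j : Fin 4) (x : Fin 4 → ℂ) : ∑ l, kron j l * x l = x j := by
  simp [kron]

lemma eps4_contract_kron (j k p q : Fin 4) :
    ∑ l, ∑ m, eps4 j k l m * (kron l p * kron m q - kron l q * kron m p) = 2 * eps4 j k p q := by
  have h : ∀ l m, eps4 j k l m * (kron l p * kron m q - kron l q * kron m p) =
      kron p l * (kron q m * eps4 j k l m) - kron q l * (kron p m * eps4 j k l m) := fun l m => by
    rw [kron_comm l p, kron_comm m q, kron_comm l q, kron_comm m p]; ring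
  simp only [h, Finset.sum_sub_distrib, ← Finset.mul_sum, sum_kron_left]
  rw [eps4_swap_right j k q p]; ring

/-- Moving a derivative to the other argument costs a sign. Zero or two derivatives therefore keep
the antisymmetry of $D$, while the single derivative in `fermiKer_swap` makes the kernel symmetric.
-/
lemma boseKer_swap {D : Test → Test → ℂ} (hD : IsWaveKernel D) (h : ∀ f g, D g f = -D f g)
    (I J : BoseField) (f g : Test) : boseKer D J I g f = -boseKer D I J f g := by
  have hdd (μ ν : Fin 4) : ddKer D μ ν g f = -ddKer D μ ν f g := by
    rw [ddKer_apply, ddKer_apply, ← neg_eq_iff_eq_neg, ← h, hD.translation, hD.translation,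
      neg_neg, pd_comm]
  cases I <;> cases J <;>
    simp only [boseKer, spinorKer, hdd, h f g, neg_zero, mul_neg, Finset.sum_neg_distrib]
  · rw [eps4_pair_symm]
  · simp only [kron_comm]; ring
  · simp only [kron_comm]; ring
  · rw [eps4_pair_symm]

lemma fermiKer_swap {D : Test → Test → ℂ} (hD : IsWaveKernel D) (h : ∀ f g, D g f = -D f g)
    (I J : FermiField) (f g : Test) : fermiKer D J I g f = fermiKer D I J f g := by
  have hd (μ : Fin 4) : dKer D μ g f = dKer D μ f g := by
    rw [dKer_apply, dKer_apply, h f, hD.translation, neg_neg]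
  cases I <;> cases J <;> simp only [fermiKer, hd]

lemma metric_comm (μ ν : Fin 4) : metric μ ν = metric ν μ := by
  by_cases e : μ = ν
  · rw [e]
  · simp [metric, e, Ne.symm e]

lemma tensorKer_swap {D : Test → Test → ℂ} (hD : IsWaveKernel D) (h : ∀ f g, D g f = -D f g)
    (μ ν ρ σ : Fin 4) (f g : Test) : tensorKer D ρ σ μ ν g f = -tensorKer D μ ν ρ σ f g := by
  have hdd (μ ν : Fin 4) : ddKer D μ ν g f = -ddKer D ν μ f g := by
    rw [ddKer_apply, ddKer_apply, ← neg_eq_iff_eq_neg, ← h, hD.translation, hD.translation,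
      neg_neg]
  simp only [tensorKer, hdd, metric_comm ρ, metric_comm σ]
  ring

/-! ### Compatibility of the kernels with the constraints. -/

lemma IsWaveKernel.spinorKer_symm {D : Test → Test → ℂ} (hD : IsWaveKernel D)
    (a b c d : Fin 2) (f g : Test) : spinorKer D a b c d f g = spinorKer D b a c d f g := by
  have h := (hD.isWaveTensor f g)
  have e (a b c d : Fin 2) : spinorKer D a b c d f g =
      2 * Complex.I * ((∑ μ, ∑ ν, pauli μ a c * pauli ν b d * ddKer D μ ν f g) +
        ∑ μ, ∑ ν, pauli μ a d * pauli ν b c * ddKer D μ ν f g) := by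
    simp only [spinorKer, Finset.mul_sum, ← Finset.sum_add_distrib]
    refine Finset.sum_congr rfl fun μ _ => Finset.sum_congr rfl fun ν _ => ?_
    ring
  rw [e, e, h.pauli_swap a b c d, h.pauli_swap a b d c, add_comm]

lemma spinorKer_symm_right (D : Test → Test → ℂ)
    (a b c d : Fin 2) (f g : Test) : spinorKer D a b c d f g = spinorKer D a b d c f g := by
  simp only [spinorKer]
  refine Finset.sum_congr rfl fun μ _ => Finset.sum_congr rfl fun ν _ => ?_
  ring

lemma IsWaveKernel.F_first_order {D : Test → Test → ℂ} (hD : IsWaveKernel D)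
    (e d p q : Fin 2) (f g : Test) :
    ∑ μ, ∑ a, ∑ c, (pauli μ a e * epsUp a c) • distDeriv μ (fun f => spinorKer D c d p q f g) f
      = 0 := by
  have key (p : Fin 2) (ρ : Fin 4) := (hD.isWaveTensor_ddd ρ f g).pauli_eps_left e p
  -- After summation over $\epsilon^{ac}$, each of the two products in `spinorKer` has one factor
  -- $\sigma^\rho$ as a spectator; the other factor pairs with the outer $\sigma^\mu$ into a
  -- vanishing $\epsilon$-contraction.
  have h : ∑ ρ, (2 * Complex.I) * (pauli ρ d q * ∑ μ, ∑ ν,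
        (pauli μ 0 e * pauli ν 1 p - pauli μ 1 e * pauli ν 0 p) * ddKer D ν ρ (pd μ f) g +
      pauli ρ d p * ∑ μ, ∑ ν,
        (pauli μ 0 e * pauli ν 1 q - pauli μ 1 e * pauli ν 0 q) * ddKer D ν ρ (pd μ f) g) = 0 := by
    simp [key]
  rw [← h]
  simp only [Fin.sum_univ_two, epsUp, distDeriv, spinorKer, Matrix.of_apply, Matrix.cons_val_zero,
    Matrix.cons_val_one, mul_zero, smul_eq_mul, mul_neg, neg_mul,
    mul_one, neg_neg, Finset.mul_sum, ← Finset.sum_add_distrib, ← Finset.sum_neg_distrib]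
  rw [Finset.sum_comm_cycle]
  refine Finset.sum_congr rfl fun ρ _ => Finset.sum_congr rfl fun μ _ =>
    Finset.sum_congr rfl fun ν _ => ?_
  ring

lemma IsWaveKernel.FBar_first_order {D : Test → Test → ℂ} (hD : IsWaveKernel D)
    (e d p q : Fin 2) (f g : Test) :
    ∑ μ, ∑ a, ∑ c, (conj (pauli μ a e) * epsUp a c) •
      distDeriv μ (fun f => spinorKer D p q c d f g) f = 0 := by
  have key (p : Fin 2) (ρ : Fin 4) := (hD.isWaveTensor_ddd ρ f g).pauli_eps_right e p
  have h : ∑ ρ, (2 * Complex.I) * (pauli ρ q d * ∑ μ, ∑ ν,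
        (pauli μ e 0 * pauli ν p 1 - pauli μ e 1 * pauli ν p 0) * ddKer D ν ρ (pd μ f) g +
      pauli ρ p d * ∑ μ, ∑ ν,
        (pauli μ e 0 * pauli ν q 1 - pauli μ e 1 * pauli ν q 0) * ddKer D ν ρ (pd μ f) g) = 0 := by
    simp [key]
  rw [← h]
  -- The second product is reordered by `pauli_swap`, so that the index $c$, which is about to be
  -- contracted, sits on $\nu$ in both terms.
  have hs (c d : Fin 2) (μ : Fin 4) : spinorKer D p q c d (pd μ f) g = ∑ ν, ∑ ρ,
      2 * Complex.I * (pauli ν p c * pauli ρ q d + pauli ν q c * pauli ρ p d) *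
        ddKer D ν ρ (pd μ f) g := by
    have e (a b c d : Fin 2) : spinorKer D a b c d (pd μ f) g =
      2 * Complex.I * ((∑ μ', ∑ ν, pauli μ' a c * pauli ν b d * ddKer D μ' ν (pd μ f) g) +
        ∑ μ', ∑ ν, pauli μ' a d * pauli ν b c * ddKer D μ' ν (pd μ f) g) := by
      simp only [spinorKer, Finset.mul_sum, ← Finset.sum_add_distrib]
      refine Finset.sum_congr rfl fun μ _ => Finset.sum_congr rfl fun ν _ => ?_
      ring
    rw [e, (hD.isWaveTensor (pd μ f) g).pauli_swap p q d c]
    simp only [Finset.mul_sum, ← Finset.sum_add_distrib]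
    refine Finset.sum_congr rfl fun μ _ => Finset.sum_congr rfl fun ν _ => ?_
    ring
  simp only [conj_pauli, Fin.sum_univ_two, epsUp, distDeriv, hs, Matrix.of_apply,
    Matrix.cons_val_zero,
    Matrix.cons_val_one, mul_zero, smul_eq_mul, mul_neg, neg_mul,
    mul_one, neg_neg, Finset.mul_sum, ← Finset.sum_add_distrib, ← Finset.sum_neg_distrib]
  rw [Finset.sum_comm_cycle]
  refine Finset.sum_congr rfl fun ρ _ => Finset.sum_congr rfl fun μ _ =>
    Finset.sum_congr rfl fun ν _ => ?_
  ring

lemma boseConstraints_boseKer {D : Test → Test → ℂ} (hD : IsWaveKernel D) (J : BoseField)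
    (g : Test) : BoseConstraints fun I f => boseKer D I J f g where
  phi_antisymm j k f := by
    cases J <;> simp only [boseKer, neg_zero]
    · rw [eps4_swap_left]; ring
    · ring
  phiBar_antisymm j k f := by
    cases J <;> simp only [boseKer, neg_zero]
    · ring
    · rw [eps4_swap_left]; ring
  phi_wave j k f := (hD.isWaveSolution_boseKer _ J g).box_eq_zero f
  phiBar_wave j k f := (hD.isWaveSolution_boseKer _ J g).box_eq_zero f
  F_wave a c f := (hD.isWaveSolution_boseKer _ J g).box_eq_zero f
  FBar_wave a c f := (hD.isWaveSolution_boseKer _ J g).box_eq_zero f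
  F_symm a c f := by
    cases J <;> simp only [boseKer]
    exact hD.spinorKer_symm _ _ _ _ f g
  FBar_symm a c f := by
    cases J <;> simp only [boseKer]
    exact spinorKer_symm_right D _ _ _ _ f g
  F_first_order e d f := by
    cases J <;> simp only [boseKer]
    case FBar => exact hD.F_first_order e d _ _ f g
    all_goals simp [distDeriv]
  FBar_first_order e d f := by
    cases J <;> simp only [boseKer]
    case F => exact hD.FBar_first_order e d _ _ f g
    all_goals simp [distDeriv]
  phi_reality j k f := by
    cases J with
    | phi p q =>
      simp only [boseKer, smul_eq_mul]
      have := eps4_contract j k p q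
      rw [← mul_assoc, mul_left_comm, ← this]
      simp only [Finset.mul_sum, Finset.sum_mul]
      refine Finset.sum_congr rfl fun l _ => Finset.sum_congr rfl fun m _ => ?_
      ring
    | phiBar p q =>
      simp only [boseKer, smul_eq_mul]
      rw [← mul_assoc, mul_left_comm, ← eps4_contract_kron]
      simp only [Finset.mul_sum, Finset.sum_mul]
      refine Finset.sum_congr rfl fun l _ => Finset.sum_congr rfl fun m _ => ?_
      ring
    | F a b => simp [boseKer]
    | FBar a b => simp [boseKer]
  phiBar_reality j k f := by
    cases J with
    | phiBar p q =>
      simp only [boseKer, smul_eq_mul]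
      have := eps4_contract j k p q
      rw [← mul_assoc, mul_left_comm, ← this]
      simp only [Finset.mul_sum, Finset.sum_mul]
      refine Finset.sum_congr rfl fun l _ => Finset.sum_congr rfl fun m _ => ?_
      ring
    | phi p q =>
      simp only [boseKer, smul_eq_mul]
      rw [← mul_assoc, mul_left_comm, ← eps4_contract_kron]
      simp only [Finset.mul_sum, Finset.sum_mul]
      refine Finset.sum_congr rfl fun l _ => Finset.sum_congr rfl fun m _ => ?_
      ring
    | F a b => simp [boseKer]
    | FBar a b => simp [boseKer]

lemma fermiConstraints_fermiKer {D : Test → Test → ℂ} (hD : IsWaveKernel D) (J : FermiField)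
    (g : Test) : FermiConstraints fun I f => fermiKer D I J f g where
  lamBar_dirac j a f := by
    cases J with
    | lamBar => simp [fermiKer, distDeriv]
    | lam k b =>
      have h := (hD.isWaveTensor f g).pauli_eps_right a b
      rw [← mul_zero (-2 * kron k j), ← h]
      simp only [fermiKer, Fin.sum_univ_two, epsUp, distDeriv, dKer_apply, ddKer_apply, Matrix.of_apply,
        Matrix.cons_val_zero, Matrix.cons_val_one, smul_eq_mul, Finset.mul_sum,
        ← Finset.sum_add_distrib, ← Finset.sum_neg_distrib]
      refine Finset.sum_congr rfl fun ρ _ => Finset.sum_congr rfl fun μ _ => ?_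
      ring
  lam_dirac j a f := by
    cases J with
    | lam => simp [fermiKer, distDeriv]
    | lamBar k b =>
      have h := (hD.isWaveTensor f g).pauli_eps_left a b
      rw [← mul_zero (-2 * kron j k), ← h]
      simp only [conj_pauli, fermiKer, Fin.sum_univ_two, epsUp, distDeriv, dKer_apply, ddKer_apply,
        Matrix.of_apply, Matrix.cons_val_zero, Matrix.cons_val_one, smul_eq_mul, Finset.mul_sum,
        ← Finset.sum_add_distrib, ← Finset.sum_neg_distrib]
      refine Finset.sum_congr rfl fun ρ _ => Finset.sum_congr rfl fun μ _ => ?_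
      ring

lemma tensorConstraints_tensorKer {D : Test → Test → ℂ} (hD : IsWaveKernel D) (ρ σ : Fin 4)
    (g : Test) : TensorConstraints fun μ ν f => tensorKer D μ ν ρ σ f g where
  antisymm μ ν f := by simp only [tensorKer]; ring
  divergence ν f := by
    have h0 (κ : Fin 4) : ddKer D 0 κ (pd 0 f) g = ddKer D 1 κ (pd 1 f) g +
        ddKer D 2 κ (pd 2 f) g + ddKer D 3 κ (pd 3 f) g := (hD.isWaveTensor_ddd κ f g).trace
    have hm (κ : Fin 4) (X : Fin 4 → ℂ) : ∑ μ, metric μ μ * (metric μ κ * X μ) = X κ := by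
      fin_cases κ <;> simp [metric]
    have hw (κ : Fin 4) : ∑ μ, metric μ μ * ddKer D μ κ (pd μ f) g = 0 := by
      simp [metric, Fin.sum_univ_four, h0]; ring
    have h : (Complex.I / 2) * ((∑ μ, metric μ μ * (metric μ ρ * ddKer D ν σ (pd μ f) g)) -
        metric ν ρ * (∑ μ, metric μ μ * ddKer D μ σ (pd μ f) g) +
        metric ν σ * (∑ μ, metric μ μ * ddKer D μ ρ (pd μ f) g) -
        ∑ μ, metric μ μ * (metric μ σ * ddKer D ν ρ (pd μ f) g)) = 0 := by
      -- The terms with $\partial^2$ vanish by `hw`; the other two are the same third derivative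
      -- with opposite signs.
      rw [hm, hm, hw, hw, ddKer_apply, ddKer_apply, pd_comm σ, pd_pd_comm ρ, pd_comm σ]
      ring
    rw [← h]
    simp only [distDeriv, tensorKer, smul_eq_mul, Finset.mul_sum, ← Finset.sum_sub_distrib,
      ← Finset.sum_add_distrib]
    refine Finset.sum_congr rfl fun μ _ => ?_
    ring
  bianchi α f := by
    -- Derivatives commute, so antisymmetrizing over two of them gives zero. The instances used
    -- below only replace a larger index by a smaller one, which fixes a normal form.
    have hs (μ ν ρ : Fin 4) : ddKer D μ ν (pd ρ f) g = ddKer D ρ ν (pd μ f) g := by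
      rw [ddKer_apply, ddKer_apply, pd_comm μ]
    have e2 : Int.sign 2 = 1 := rfl
    have e3 : Int.sign 3 = 1 := rfl
    fin_cases α <;>
      simp [eps4, Fin.sum_univ_four, e2, e3, distDeriv, tensorKer, hs 1 _ 0, hs 2 _ 0, hs 3 _ 0,
        hs 2 _ 1, hs 3 _ 1, hs 3 _ 2] <;> ring

lemma distDeriv_neg (μ : Fin 4) (T : Test → ℂ) : distDeriv μ (-T) = -distDeriv μ T := rfl

/-- The constraints are linear and homogeneous. The sign arises when they are transferred to the
second argument of a commutator. -/
lemma BoseConstraints.neg {b : BoseField → Test → ℂ} (h : BoseConstraints b) :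
    BoseConstraints (-b) where
  phi_antisymm j k f := congrArg Neg.neg (h.phi_antisymm j k f)
  phiBar_antisymm j k f := congrArg Neg.neg (h.phiBar_antisymm j k f)
  phi_wave j k f := by simpa [box, distDeriv_neg] using h.phi_wave j k f
  phiBar_wave j k f := by simpa [box, distDeriv_neg] using h.phiBar_wave j k f
  F_wave j k f := by simpa [box, distDeriv_neg] using h.F_wave j k f
  FBar_wave j k f := by simpa [box, distDeriv_neg] using h.FBar_wave j k f
  F_symm a c f := by simpa using h.F_symm a c f
  FBar_symm a c f := by simpa using h.FBar_symm a c f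
  F_first_order e d f := by
    have := h.F_first_order e d f
    simp only [Pi.neg_apply, distDeriv_neg, smul_neg, Finset.sum_neg_distrib, this, neg_zero]
  FBar_first_order e d f := by
    have := h.FBar_first_order e d f
    simp only [Pi.neg_apply, distDeriv_neg, smul_neg, Finset.sum_neg_distrib, this, neg_zero]
  phi_reality j k f := by
    simp only [Pi.neg_apply, smul_neg, Finset.sum_neg_distrib, h.phi_reality]
  phiBar_reality j k f := by
    simp only [Pi.neg_apply, smul_neg, Finset.sum_neg_distrib, h.phiBar_reality]

lemma TensorConstraints.neg {T : Fin 4 → Fin 4 → Test → ℂ} (h : TensorConstraints T) :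
    TensorConstraints (-T) where
  antisymm μ ν f := congrArg Neg.neg (h.antisymm μ ν f)
  divergence ν f := by
    simp only [Pi.neg_apply, distDeriv_neg, smul_neg, Finset.sum_neg_distrib, h.divergence,
      neg_zero]
  bianchi α f := by
    simp only [Pi.neg_apply, distDeriv_neg, smul_neg, Finset.sum_neg_distrib, h.bianchi, neg_zero]

/-! ### Covariance under the internal symmetry group -/

lemma kron_eq_one (j k : Fin 4) : kron j k = (1 : Matrix (Fin 4) (Fin 4) ℂ) j k := by
  simp [kron, Matrix.one_apply]

lemma det_eq_sum_eps4 (A : Matrix (Fin 4) (Fin 4) ℂ) :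
    ∑ j, ∑ k, ∑ l, ∑ m, A 0 j * A 1 k * A 2 l * A 3 m * eps4 j k l m = A.det := by
  have e2 : Int.sign 2 = 1 := rfl
  have e3 : Int.sign 3 = 1 := rfl
  simp [Matrix.det_succ_row_zero, Fin.sum_univ_succ, eps4, e2, e3, Fin.succAbove]
  ring

lemma eps4_eq_det (j k l m : Fin 4) :
    eps4 j k l m = ((1 : Matrix (Fin 4) (Fin 4) ℂ).submatrix ![j, k, l, m] id).det := by
  rw [← det_eq_sum_eps4]
  simp [← kron_eq_one, mul_assoc, ← Finset.mul_sum, sum_kron_left]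

/-- The rows $j,k,l,m$ of $U$ form $PU$, where $P$ consists of the same rows of the identity and
$\det P=\epsilon_{jklm}$; the determinant is multiplicative. -/
lemma sum_mul_eps4 (U : Matrix (Fin 4) (Fin 4) ℂ) (j k l m : Fin 4) :
    ∑ j', ∑ k', ∑ l', ∑ m', U j j' * U k k' * U l l' * U m m' * eps4 j' k' l' m' =
      U.det * eps4 j k l m := by
  have h := det_eq_sum_eps4 (U.submatrix ![j, k, l, m] id)
  have h2 : U.submatrix ![j, k, l, m] id =
      (1 : Matrix (Fin 4) (Fin 4) ℂ).submatrix ![j, k, l, m] id * U := by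
    generalize ![j, k, l, m] = v
    ext a b
    simp [Matrix.mul_apply, Matrix.one_apply]
  rw [h2, Matrix.det_mul, ← eps4_eq_det, ← h2, mul_comm] at h
  rw [← h]
  rfl

lemma sum_mul_star_of_mem_unitary {U : Matrix (Fin 4) (Fin 4) ℂ}
    (hU : U ∈ Matrix.unitaryGroup (Fin 4) ℂ) (j l : Fin 4) :
    ∑ i, U j i * star (U l i) = kron j l := by
  have := congrFun (congrFun (Matrix.mem_unitaryGroup_iff.1 hU) j) l
  rw [kron_eq_one, ← this, Matrix.mul_apply]
  rfl

lemma boseKer_phi_phiBar_covariant (D : Test → Test → ℂ) {U : Matrix (Fin 4) (Fin 4) ℂ}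
    (hU : U ∈ Matrix.unitaryGroup (Fin 4) ℂ) (j k l m : Fin 4) (f g : Test) :
    ∑ j', ∑ k', ∑ l', ∑ m', U j j' * U k k' * star (U l l') * star (U m m') *
        boseKer D (.phi j' k') (.phiBar l' m') f g = boseKer D (.phi j k) (.phiBar l m) f g := by
  have h (x y z w : Fin 4) : (∑ i, U x i * star (U y i)) * (∑ i, U z i * star (U w i)) =
      kron x y * kron z w := by
    rw [sum_mul_star_of_mem_unitary hU, sum_mul_star_of_mem_unitary hU]
  simp only [boseKer]
  -- The Kronecker deltas on the right are opened into $UU^*$, so that both sides become sums over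
  -- $j',k'$ of the same terms.
  rw [← h, ← h]
  have e (x y z w : Fin 4) : (∑ i, U x i * star (U y i)) * (∑ i, U z i * star (U w i)) =
      ∑ j', ∑ k', U x j' * U z k' * star (U y j') * star (U w k') := by
    rw [Finset.sum_mul_sum]
    refine Finset.sum_congr rfl fun _ _ => Finset.sum_congr rfl fun _ _ => ?_
    ring
  rw [e, e]
  have e1 (j' k' : Fin 4) : ∑ l', ∑ m', U j j' * U k k' * star (U l l') * star (U m m') *
      (-Complex.I * (kron j' l' * kron k' m' - kron j' m' * kron k' l') * D f g) =
      -Complex.I * (U j j' * U k k' * star (U l j') * star (U m k') -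
        U j j' * U k k' * star (U m j') * star (U l k')) * D f g := by
    have e2 (l' m' : Fin 4) : U j j' * U k k' * star (U l l') * star (U m m') *
      (-Complex.I * (kron j' l' * kron k' m' - kron j' m' * kron k' l') * D f g) =
      -Complex.I * U j j' * U k k' * D f g * (kron j' l' * (kron k' m' * (star (U l l') * star (U m m'))))
      - -Complex.I * U j j' * U k k' * D f g * (kron k' l' * (kron j' m' * (star (U l l') * star (U m m')))) := by
      ring
    simp only [e2, Finset.sum_sub_distrib, ← Finset.mul_sum, sum_kron_left]
    ring
  simp only [e1, ← Finset.sum_mul, ← Finset.mul_sum, Finset.sum_sub_distrib]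

lemma boseKer_phi_phi_covariant (D : Test → Test → ℂ) {U : Matrix (Fin 4) (Fin 4) ℂ}
    (hU : U.det = 1) (j k l m : Fin 4) (f g : Test) :
    ∑ j', ∑ k', ∑ l', ∑ m', U j j' * U k k' * U l l' * U m m' *
        boseKer D (.phi j' k') (.phi l' m') f g = boseKer D (.phi j k) (.phi l m) f g := by
  have h := sum_mul_eps4 U j k l m
  rw [hU, one_mul] at h
  simp only [boseKer]
  rw [← h]
  simp only [Finset.mul_sum, Finset.sum_mul]
  refine Finset.sum_congr rfl fun _ _ => Finset.sum_congr rfl fun _ _ =>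
    Finset.sum_congr rfl fun _ _ => Finset.sum_congr rfl fun _ _ => ?_
  ring

section

open MeasureTheory
open scoped ComplexOrder

/-! ### Positivity -/

/-- `φ` is integrable with integral `c`. -/
def HasIntegralValue (φ : EuclideanSpace ℝ (Fin 3) → ℂ) (c : ℂ) : Prop :=
  Integrable φ ∧ ∫ k, φ k = c

namespace HasIntegralValue

variable {φ ψ : EuclideanSpace ℝ (Fin 3) → ℂ} {c d : ℂ}

lemma zero : HasIntegralValue (fun _ => 0) 0 := ⟨integrable_zero _ _ _, by simp⟩

lemma const_mul (h : HasIntegralValue φ c) (r : ℂ) :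
    HasIntegralValue (fun k => r * φ k) (r * c) :=
  ⟨h.1.const_mul r, by rw [integral_const_mul, h.2]⟩

lemma neg (h : HasIntegralValue φ c) : HasIntegralValue (fun k => -φ k) (-c) :=
  ⟨h.1.neg, by rw [integral_neg, h.2]⟩

lemma add (h : HasIntegralValue φ c) (h' : HasIntegralValue ψ d) :
    HasIntegralValue (fun k => φ k + ψ k) (c + d) :=
  ⟨h.1.add h'.1, by rw [integral_add h.1 h'.1, h.2, h'.2]⟩

lemma sub (h : HasIntegralValue φ c) (h' : HasIntegralValue ψ d) :
    HasIntegralValue (fun k => φ k - ψ k) (c - d) :=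
  ⟨h.1.sub h'.1, by rw [integral_sub h.1 h'.1, h.2, h'.2]⟩

lemma sum {ι : Type*} (s : Finset ι) {φ : ι → EuclideanSpace ℝ (Fin 3) → ℂ} {c : ι → ℂ}
    (h : ∀ i, HasIntegralValue (φ i) (c i)) :
    HasIntegralValue (fun k => ∑ i ∈ s, φ i k) (∑ i ∈ s, c i) :=
  ⟨integrable_finsetSum _ fun i _ => (h i).1, by
    rw [integral_finsetSum _ fun i _ => (h i).1]
    exact Finset.sum_congr rfl fun i _ => (h i).2⟩

end HasIntegralValue

/-- The contribution of the momentum `k` to `pauliJordanPlus`. -/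
noncomputable def modeKer (k : EuclideanSpace ℝ (Fin 3)) (f g : Test) : ℂ :=
  Complex.I / (2 * (Real.pi : ℂ)) ^ 3 *
    ((1 / (2 * (‖k‖ : ℂ))) * coneFourier (-1) f k * coneFourier 1 g k)

lemma hasIntegralValue_modeKer (f g : Test) :
    HasIntegralValue (fun k => modeKer k f g) (pauliJordanPlus f g) :=
  (show HasIntegralValue _ _ from ⟨integrable_pauliJordanPlus f g, rfl⟩).const_mul _

/-- Every kernel is a finite linear combination of $D$ evaluated on differentiated test functions,
hence it commutes with the momentum integral. -/
lemma hasIntegralValue_dKer (μ : Fin 4) (f g : Test) :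
    HasIntegralValue (fun k => dKer (modeKer k) μ f g) (dKer pauliJordanPlus μ f g) :=
  (hasIntegralValue_modeKer _ g).neg

lemma hasIntegralValue_ddKer (μ ν : Fin 4) (f g : Test) :
    HasIntegralValue (fun k => ddKer (modeKer k) μ ν f g) (ddKer pauliJordanPlus μ ν f g) :=
  (hasIntegralValue_modeKer _ g).neg.neg

lemma hasIntegralValue_spinorKer (a b c d : Fin 2) (f g : Test) :
    HasIntegralValue (fun k => spinorKer (modeKer k) a b c d f g)
      (spinorKer pauliJordanPlus a b c d f g) :=
  .sum _ fun μ => .sum _ fun ν => (hasIntegralValue_ddKer μ ν f g).const_mul _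

lemma hasIntegralValue_boseKer (I J : BoseField) (f g : Test) :
    HasIntegralValue (fun k => boseKer (modeKer k) I J f g) (boseKer pauliJordanPlus I J f g) := by
  cases I <;> cases J <;>
    first
    | exact .zero
    | exact (hasIntegralValue_modeKer f g).const_mul _
    | exact hasIntegralValue_spinorKer _ _ _ _ f g

lemma hasIntegralValue_fermiKer (I J : FermiField) (f g : Test) :
    HasIntegralValue (fun k => fermiKer (modeKer k) I J f g)
      (fermiKer pauliJordanPlus I J f g) := by
  cases I <;> cases J <;>
    first
    | exact .zero
    | exact .sum _ fun μ => (hasIntegralValue_dKer μ f g).const_mul _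

lemma hasIntegralValue_tensorKer (μ ν ρ σ : Fin 4) (f g : Test) :
    HasIntegralValue (fun k => tensorKer (modeKer k) μ ν ρ σ f g)
      (tensorKer pauliJordanPlus μ ν ρ σ f g) := by
  have h (α β γ δ : Fin 4) := (hasIntegralValue_ddKer α β f g).const_mul (metric γ δ)
  exact ((((h _ _ _ _).sub (h _ _ _ _)).add (h _ _ _ _)).sub (h _ _ _ _)).const_mul _

/-- Reduces positivity to a finite-dimensional Hermitian form at each momentum. Nonnegativity in ℂ
includes reality of the integrand. -/
lemma positivity_of_hasIntegralValue {ι : Type} [Fintype ι] {bar : ι → ι}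
    {w : EuclideanSpace ℝ (Fin 3) → ι → ι → Test → Test → ℂ} {W : ι → ι → Test → Test → ℂ}
    (hW : ∀ I J f g, HasIntegralValue (fun k => w k I J f g) (W I J f g))
    (hw : ∀ k (f : ι → Test), 0 ≤ ∑ I, ∑ J, w k (bar I) J (testConj (f I)) (f J)) :
    Positivity bar W := by
  intro f
  have h : HasIntegralValue (fun k => ∑ I, ∑ J, w k (bar I) J (testConj (f I)) (f J))
      (∑ I, ∑ J, W (bar I) J (testConj (f I)) (f J)) :=
    .sum _ fun I => .sum _ fun J => hW _ _ _ _
  have e (k : EuclideanSpace ℝ (Fin 3)) : ∑ I, ∑ J, w k (bar I) J (testConj (f I)) (f J) =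
      (((∑ I, ∑ J, w k (bar I) J (testConj (f I)) (f J)).re : ℝ) : ℂ) := by
    exact Complex.ext rfl (by simpa using (Complex.nonneg_iff.1 (hw k f)).2.symm)
  rw [← h.2, integral_congr_ae (.of_forall e), integral_complex_ofReal]
  exact ⟨integral_nonneg fun k => (Complex.nonneg_iff.1 (hw k f)).1, rfl⟩

/-- The weight of the momentum `k` in the `2`-point function. -/
noncomputable def modeWeight (k : EuclideanSpace ℝ (Fin 3)) : ℂ :=
  1 / (2 * (Real.pi : ℂ)) ^ 3 * (1 / (2 * (‖k‖ : ℂ)))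

lemma modeWeight_nonneg (k : EuclideanSpace ℝ (Fin 3)) : 0 ≤ modeWeight k := by
  have : modeWeight k = ((1 / (2 * Real.pi) ^ 3 * (1 / (2 * ‖k‖)) : ℝ) : ℂ) := by
    simp [modeWeight]
  rw [this, Complex.zero_le_real]
  have := Real.pi_pos
  positivity

lemma modeKer_testConj (k : EuclideanSpace ℝ (Fin 3)) (f g : Test) :
    modeKer k (testConj f) g =
      Complex.I * (modeWeight k * (conj (coneFourier 1 f k) * coneFourier 1 g k)) := by
  rw [modeKer, coneFourier_testConj, modeWeight]
  ring

/-- The $i$ of the derivative combines with the $i$ in $D_0^{(+)}$ to leave a real factor $p_\mu$.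
With two derivatives a factor $-i$ remains, which the prefactors of `spinorKer` and `tensorKer` make
real. -/
lemma dKer_modeKer_testConj (k : EuclideanSpace ℝ (Fin 3)) (μ : Fin 4) (f g : Test) :
    dKer (modeKer k) μ (testConj f) g =
      coneMomentum k μ * (modeWeight k * (conj (coneFourier 1 f k) * coneFourier 1 g k)) := by
  have h := modeKer_testConj k f g
  have h2 : modeKer k (pd μ (testConj f)) g =
      Complex.I * coneMomentum k μ * modeKer k (testConj f) g := by
    rw [modeKer, modeKer, coneFourier_pd]; push_cast; ring
  rw [dKer_apply, h2, h]
  linear_combination (-(coneMomentum k μ : ℂ) *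
    (modeWeight k * (conj (coneFourier 1 f k) * coneFourier 1 g k))) * Complex.I_sq

lemma ddKer_modeKer_testConj (k : EuclideanSpace ℝ (Fin 3)) (μ ν : Fin 4) (f g : Test) :
    ddKer (modeKer k) μ ν (testConj f) g =
      -Complex.I * (coneMomentum k μ * coneMomentum k ν *
        (modeWeight k * (conj (coneFourier 1 f k) * coneFourier 1 g k))) := by
  have h := modeKer_testConj k f g
  have h2 : modeKer k (pd ν (pd μ (testConj f))) g =
      Complex.I ^ 2 * (coneMomentum k μ * coneMomentum k ν) * modeKer k (testConj f) g := by
    rw [modeKer, modeKer, coneFourier_pd, coneFourier_pd]; push_cast; ring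
  rw [ddKer_apply, h2, h, Complex.I_sq]
  ring

lemma coneMomentum_zero_nonneg (k : EuclideanSpace ℝ (Fin 3)) : 0 ≤ coneMomentum k 0 :=
  norm_nonneg k

/-- `p_μ σ^μ` has rank at most one on the light cone. -/
lemma exists_pauli_momentum_eq (k : EuclideanSpace ℝ (Fin 3)) :
    ∃ u : Fin 2 → ℂ, ∀ a b, ∑ μ, pauli μ a b * coneMomentum k μ = u a * conj (u b) := by
  have hsq := coneMomentum_sq k
  have h0 := coneMomentum_zero_nonneg k
  generalize coneMomentum k = p at hsq h0
  have hA : 0 ≤ p 0 + p 3 := by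
    nlinarith [sq_nonneg (p 1), sq_nonneg (p 2), sq_nonneg (p 0 + p 3)]
  have hB : 0 ≤ p 0 - p 3 := by
    nlinarith [sq_nonneg (p 1), sq_nonneg (p 2), sq_nonneg (p 0 - p 3)]
  -- The matrix has diagonal $p_0+p_3$, $p_0-p_3$ and determinant $p^2=0$. If $p_0+p_3=0$ only the
  -- lower right entry survives; otherwise $u$ is the first column divided by $\sqrt{p_0+p_3}$.
  rcases hA.eq_or_lt with hA | hA
  · have h1 : p 1 = 0 := by nlinarith [sq_nonneg (p 1), sq_nonneg (p 2)]
    have h2 : p 2 = 0 := by nlinarith [sq_nonneg (p 1), sq_nonneg (p 2)]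
    have h3 : p 3 = -p 0 := by linarith
    have hs : ((Real.sqrt (p 0 - p 3) : ℝ) : ℂ) * (Real.sqrt (p 0 - p 3) : ℝ) = p 0 - p 3 := by
      exact_mod_cast Real.mul_self_sqrt hB
    refine ⟨![0, (Real.sqrt (p 0 - p 3) : ℝ)], fun a b => ?_⟩
    fin_cases a <;> fin_cases b <;> simp [Fin.sum_univ_four, pauli, h1, h2, hs] <;> simp [h3]
  · have hs : ((Real.sqrt (p 0 + p 3) : ℝ) : ℂ) * (Real.sqrt (p 0 + p 3) : ℝ) = p 0 + p 3 := by
      exact_mod_cast Real.mul_self_sqrt hA.le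
    have hs0 : ((Real.sqrt (p 0 + p 3) : ℝ) : ℂ) ≠ 0 := by
      exact_mod_cast (Real.sqrt_pos.2 hA).ne'
    have hsq' : (p 0 : ℂ) ^ 2 = p 1 ^ 2 + p 2 ^ 2 + p 3 ^ 2 := by exact_mod_cast hsq
    refine ⟨![(Real.sqrt (p 0 + p 3) : ℝ),
      (p 1 + Complex.I * p 2) / (Real.sqrt (p 0 + p 3) : ℝ)], fun a b => ?_⟩
    fin_cases a <;> fin_cases b <;> simp [Fin.sum_univ_four, pauli, hs]
    · field_simp
    · field_simp
    · rw [div_mul_div_comm, hs, eq_div_iff (by rw [← hs]; exact mul_ne_zero hs0 hs0)]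
      linear_combination hsq' + (p 2 : ℂ) ^ 2 * Complex.I_sq

lemma sum_fermiField (x : FermiField → ℂ) :
    ∑ I, x I = (∑ j, ∑ a, x (.lam j a)) + ∑ j, ∑ a, x (.lamBar j a) := by
  let e : (Fin 4 × Fin 2) ⊕ (Fin 4 × Fin 2) ≃ FermiField :=
    { toFun := Sum.elim (fun p => .lam p.1 p.2) (fun p => .lamBar p.1 p.2)
      invFun := fun I => match I with
        | .lam j a => .inl (j, a)
        | .lamBar j a => .inr (j, a)
      left_inv := by rintro (_ | _) <;> rfl
      right_inv := by rintro (_ | _) <;> rfl }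
  rw [← e.sum_comp]
  simp [e, Fintype.sum_sum_type, Fintype.sum_prod_type]

lemma sum_boseField (x : BoseField → ℂ) :
    ∑ I, x I = (∑ j, ∑ k, x (.phi j k)) + (∑ j, ∑ k, x (.phiBar j k)) +
      (∑ a, ∑ b, x (.F a b)) + ∑ a, ∑ b, x (.FBar a b) := by
  let e : (Fin 4 × Fin 4) ⊕ (Fin 4 × Fin 4) ⊕ (Fin 2 × Fin 2) ⊕ (Fin 2 × Fin 2) ≃ BoseField :=
    { toFun := Sum.elim (fun p => .phi p.1 p.2) (Sum.elim (fun p => .phiBar p.1 p.2)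
        (Sum.elim (fun p => .F p.1 p.2) (fun p => .FBar p.1 p.2)))
      invFun := fun I => match I with
        | .phi j a => .inl (j, a)
        | .phiBar j a => .inr (.inl (j, a))
        | .F j a => .inr (.inr (.inl (j, a)))
        | .FBar j a => .inr (.inr (.inr (j, a)))
      left_inv := by rintro (_ | _ | _ | _) <;> rfl
      right_inv := by rintro (_ | _ | _ | _) <;> rfl }
  rw [← e.sum_comp]
  simp [e, Fintype.sum_sum_type, Fintype.sum_prod_type, add_assoc]

lemma conj_mul_self_nonneg (z : ℂ) : 0 ≤ conj z * z := star_mul_self_nonneg z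

/-- With $p_\mu\sigma^\mu=uu^*$, each mode is a nonnegative multiple of $\sum_j|\sum_a
u_aF(\lambda_{ja})|^2$ plus the analogous sum with $\bar u$ for $\bar\lambda$. -/
lemma positivity_fermiKer : Positivity FermiField.bar (fermiKer pauliJordanPlus) := by
  refine positivity_of_hasIntegralValue hasIntegralValue_fermiKer fun k f => ?_
  obtain ⟨u, hu⟩ := exists_pauli_momentum_eq k
  set F : FermiField → ℂ := fun I => coneFourier 1 (f I) k with hF
  have h1 (j l : Fin 4) (a b : Fin 2) (x y : Test) :
      ∑ μ, 2 * kron j l * pauli μ a b * dKer (modeKer k) μ (testConj x) y =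
        2 * modeWeight k * (kron j l * (u a * conj (u b)) *
          (conj (coneFourier 1 x k) * coneFourier 1 y k)) := by
    rw [← hu, Finset.mul_sum, Finset.sum_mul, Finset.mul_sum]
    refine Finset.sum_congr rfl fun μ _ => ?_
    rw [dKer_modeKer_testConj]
    ring
  have h2 (j : Fin 4) (a : Fin 2) : ∑ l, ∑ b, fermiKer (modeKer k) (.lamBar j a) (.lam l b)
      (testConj (f (.lam j a))) (f (.lam l b)) =
      2 * modeWeight k * (conj (u a * F (.lam j a)) * ∑ b, u b * F (.lam j b)) := by
    simp only [fermiKer, h1, kron_comm _ j, map_mul]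
    simp [kron, hF]
    ring
  have h3 (j : Fin 4) (a : Fin 2) : ∑ l, ∑ b, fermiKer (modeKer k) (.lam j a) (.lamBar l b)
      (testConj (f (.lamBar j a))) (f (.lamBar l b)) =
      2 * modeWeight k *
        (conj (conj (u a) * F (.lamBar j a)) * ∑ b, conj (u b) * F (.lamBar j b)) := by
    simp only [fermiKer, h1, map_mul]
    simp [kron, hF]
    ring
  have h4 (j l : Fin 4) (a b : Fin 2) (x y : Test) :
      fermiKer (modeKer k) (.lam j a) (.lam l b) x y = 0 := rfl
  have h5 (j l : Fin 4) (a b : Fin 2) (x y : Test) :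
      fermiKer (modeKer k) (.lamBar j a) (.lamBar l b) x y = 0 := rfl
  rw [sum_fermiField]
  simp only [sum_fermiField, FermiField.bar, h4, h5, Finset.sum_const_zero, add_zero, zero_add, h2,
    h3, ← Finset.mul_sum, ← Finset.sum_mul, ← map_sum]
  have hw := mul_nonneg (zero_le_two (α := ℂ)) (modeWeight_nonneg k)
  exact add_nonneg
    (mul_nonneg hw (Finset.sum_nonneg fun j _ => conj_mul_self_nonneg _))
    (mul_nonneg hw (Finset.sum_nonneg fun j _ => conj_mul_self_nonneg _))

/-- The kernel sees only the antisymmetric part of $F$ contracted once with $p$, and the remaining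
metric gives the Minkowski square of that vector. -/
lemma tensor_quadratic_form (F : Fin 4 → Fin 4 → ℂ) (p : Fin 4 → ℝ) (v : Fin 4 → ℂ)
    (hv : ∀ μ, v μ = ∑ ν, (F μ ν - F ν μ) * p ν) :
    ∑ μ, ∑ ν, ∑ ρ, ∑ σ, (metric μ ρ * (p ν * p σ) - metric ν ρ * (p μ * p σ)
        + metric ν σ * (p μ * p ρ) - metric μ σ * (p ν * p ρ)) * (conj (F μ ν) * F ρ σ) =
      conj (v 0) * v 0 - (conj (v 1) * v 1 + conj (v 2) * v 2 + conj (v 3) * v 3) := by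
  have h (μ ν : Fin 4) : ∑ ρ, ∑ σ, (metric μ ρ * (p ν * p σ) - metric ν ρ * (p μ * p σ)
        + metric ν σ * (p μ * p ρ) - metric μ σ * (p ν * p ρ)) * (conj (F μ ν) * F ρ σ) =
      conj (F μ ν) * (metric μ μ * p ν * v μ - metric ν ν * p μ * v ν) := by
    rw [hv, hv]
    fin_cases μ <;> fin_cases ν <;> simp [metric, Fin.sum_univ_four] <;> ring
  simp only [h]
  have h' (μ : Fin 4) : conj (v μ) = ∑ ν, (conj (F μ ν) - conj (F ν μ)) * p ν := by
    simp [hv, map_sum]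
  simp only [h']
  simp [metric, Fin.sum_univ_four]
  ring

lemma positivity_tensorKer : Positivity (ι := Fin 4 × Fin 4) id
    (fun I J => tensorKer pauliJordanPlus I.1 I.2 J.1 J.2) := by
  refine positivity_of_hasIntegralValue (fun I J => hasIntegralValue_tensorKer _ _ _ _)
    fun k f => ?_
  set F : Fin 4 → Fin 4 → ℂ := fun μ ν => coneFourier 1 (f (μ, ν)) k with hF
  set v : Fin 4 → ℂ := fun μ => ∑ ν, (F μ ν - F ν μ) * coneMomentum k ν with hv
  have hform : ∑ I : Fin 4 × Fin 4, ∑ J : Fin 4 × Fin 4,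
      tensorKer (modeKer k) (id I).1 (id I).2 J.1 J.2 (testConj (f I)) (f J) =
      modeWeight k / 2 *
        (conj (v 1) * v 1 + conj (v 2) * v 2 + conj (v 3) * v 3 - conj (v 0) * v 0) := by
    have h := tensor_quadratic_form F (coneMomentum k) v fun μ => rfl
    rw [← neg_sub (conj (v 0) * v 0), mul_neg, ← neg_mul, ← h]
    simp only [Fintype.sum_prod_type, Finset.mul_sum, id]
    refine Finset.sum_congr rfl fun μ _ => Finset.sum_congr rfl fun ν _ =>
      Finset.sum_congr rfl fun ρ _ => Finset.sum_congr rfl fun σ _ => ?_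
    simp only [tensorKer, ddKer_modeKer_testConj, hF]
    linear_combination (modeWeight k * conj (coneFourier 1 (f (μ, ν)) k) *
      coneFourier 1 (f (ρ, σ)) k * (metric μ ρ * (coneMomentum k ν * coneMomentum k σ) -
        metric ν ρ * (coneMomentum k μ * coneMomentum k σ)
        + metric ν σ * (coneMomentum k μ * coneMomentum k ρ) -
        metric μ σ * (coneMomentum k ν * coneMomentum k ρ)) / 2) * Complex.I_sq
  have hsq := coneMomentum_sq k
  have h0 := coneMomentum_zero_nonneg k
  -- Antisymmetry gives $\sum_\mu p_\mu v_\mu=0$; a vector orthogonal to a nonzero lightlike one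
  -- cannot be timelike.
  have hvp : (coneMomentum k 0 : ℂ) * v 0 =
      -(coneMomentum k 1 * v 1 + coneMomentum k 2 * v 2 + coneMomentum k 3 * v 3) := by
    simp only [hv, Fin.sum_univ_four]
    ring
  rw [hform]
  refine mul_nonneg (div_nonneg (modeWeight_nonneg k) zero_le_two) ?_
  clear hform
  rcases h0.eq_or_lt with h0 | h0
  · have h1 : coneMomentum k 1 = 0 := by
      nlinarith [sq_nonneg (coneMomentum k 1), sq_nonneg (coneMomentum k 2),
        sq_nonneg (coneMomentum k 3)]
    have h2 : coneMomentum k 2 = 0 := by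
      nlinarith [sq_nonneg (coneMomentum k 1), sq_nonneg (coneMomentum k 2),
        sq_nonneg (coneMomentum k 3)]
    have h3 : coneMomentum k 3 = 0 := by
      nlinarith [sq_nonneg (coneMomentum k 1), sq_nonneg (coneMomentum k 2),
        sq_nonneg (coneMomentum k 3)]
    simp [hv, Fin.sum_univ_four, ← h0, h1, h2, h3]
  · generalize coneMomentum k = p at *
    have hvp' : (p 0 : ℂ) * conj (v 0) =
        -(p 1 * conj (v 1) + p 2 * conj (v 2) + p 3 * conj (v 3)) := by
      simpa using congrArg conj hvp
    have hsq' : (p 0 : ℂ) ^ 2 = p 1 ^ 2 + p 2 ^ 2 + p 3 ^ 2 := by exact_mod_cast hsq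
    clear_value v
    -- Lagrange's identity $|\vec p|^2|\vec v|^2-|\vec p\cdot\vec v|^2=|\vec p\times\vec v|^2$, with
    -- $p_0^2=|\vec p|^2$ and $p_0v_0=-\vec p\cdot\vec v$.
    have key : (p 0 : ℂ) ^ 2 *
        (conj (v 1) * v 1 + conj (v 2) * v 2 + conj (v 3) * v 3 - conj (v 0) * v 0) =
        conj (p 1 * v 2 - p 2 * v 1) * (p 1 * v 2 - p 2 * v 1) +
        conj (p 2 * v 3 - p 3 * v 2) * (p 2 * v 3 - p 3 * v 2) +
        conj (p 3 * v 1 - p 1 * v 3) * (p 3 * v 1 - p 1 * v 3) := by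
      simp only [map_sub, map_mul, Complex.conj_ofReal]
      linear_combination (conj (v 1) * v 1 + conj (v 2) * v 2 + conj (v 3) * v 3) * hsq' -
        (p 0 : ℂ) * conj (v 0) * hvp +
        (p 1 * v 1 + p 2 * v 2 + p 3 * v 3) * hvp'
    have hp : (p 0 : ℂ) ^ 2 ≠ 0 := by exact_mod_cast (pow_pos h0 2).ne'
    have hp' : (0 : ℂ) ≤ ((p 0 : ℂ) ^ 2)⁻¹ := by
      exact_mod_cast inv_nonneg.2 (pow_nonneg h0.le 2)
    rw [← inv_mul_cancel_left₀ hp (_ - _), key]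
    refine mul_nonneg hp' ?_
    exact add_nonneg (add_nonneg (conj_mul_self_nonneg _) (conj_mul_self_nonneg _))
      (conj_mul_self_nonneg _)

/-- Since $2\phi^*_{lm}=\epsilon_{lmjk}\phi_{jk}$, the field
$\sum(x_{jk}\phi_{jk}+y_{jk}\phi^*_{jk})$ equals $\frac12\sum z_{jk}\phi_{jk}$ with
$z=x-x^T+\epsilon y$. The form is therefore half the squared length of $z$. -/
lemma scalar_quadratic_form (x y : Fin 4 → Fin 4 → ℂ) :
    (∑ j, ∑ k, ∑ l, ∑ m, (kron j l * kron k m - kron j m * kron k l) *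
        (conj (x j k) * x l m + conj (y j k) * y l m)) +
      (∑ j, ∑ k, ∑ l, ∑ m, eps4 j k l m * (conj (x j k) * y l m + conj (y j k) * x l m)) =
    (1 / 2) * ∑ j, ∑ k, conj (x j k - x k j + ∑ l, ∑ m, eps4 j k l m * y l m) *
      (x j k - x k j + ∑ l, ∑ m, eps4 j k l m * y l m) := by
  have e2 : Int.sign 2 = 1 := rfl
  have e3 : Int.sign 3 = 1 := rfl
  simp [Fin.sum_univ_four, eps4, e2, e3, kron]
  ring

lemma positivity_boseKer : Positivity BoseField.bar (boseKer pauliJordanPlus) := by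
  refine positivity_of_hasIntegralValue hasIntegralValue_boseKer fun k f => ?_
  obtain ⟨u, hu⟩ := exists_pauli_momentum_eq k
  set F : BoseField → ℂ := fun I => coneFourier 1 (f I) k with hF
  have hs (a b c d : Fin 2) (x y : Test) : spinorKer (modeKer k) a b c d (testConj x) y =
      4 * modeWeight k * (u a * u b * conj (u c) * conj (u d)) *
        (conj (coneFourier 1 x k) * coneFourier 1 y k) := by
    have h : ∑ μ, ∑ ν, 2 * modeWeight k * (conj (coneFourier 1 x k) * coneFourier 1 y k) *
        (pauli μ a c * coneMomentum k μ * (pauli ν b d * coneMomentum k ν) +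
          pauli μ a d * coneMomentum k μ * (pauli ν b c * coneMomentum k ν)) =
        4 * modeWeight k * (u a * u b * conj (u c) * conj (u d)) *
        (conj (coneFourier 1 x k) * coneFourier 1 y k) := by
      simp only [← Finset.mul_sum, Finset.sum_add_distrib, ← Finset.sum_mul, hu]
      ring
    rw [← h, spinorKer]
    refine Finset.sum_congr rfl fun μ _ => Finset.sum_congr rfl fun ν _ => ?_
    rw [ddKer_modeKer_testConj]
    linear_combination (-2 * (pauli μ a c * pauli ν b d + pauli μ a d * pauli ν b c) *
      (coneMomentum k μ * coneMomentum k ν *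
        (modeWeight k * (conj (coneFourier 1 x k) * coneFourier 1 y k)))) * Complex.I_sq
  have hF1 : ∑ a, ∑ b, ∑ c, ∑ d, boseKer (modeKer k) (.FBar a b) (.F c d)
      (testConj (f (.F a b))) (f (.F c d)) = 4 * modeWeight k *
        (conj (∑ c, ∑ d, u c * u d * F (.F c d)) * ∑ c, ∑ d, u c * u d * F (.F c d)) := by
    simp only [boseKer, hs, hF, Fin.sum_univ_two, map_add, map_mul]
    ring
  have hF2 : ∑ a, ∑ b, ∑ c, ∑ d, boseKer (modeKer k) (.F a b) (.FBar c d)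
      (testConj (f (.FBar a b))) (f (.FBar c d)) = 4 * modeWeight k *
        (conj (∑ c, ∑ d, conj (u c) * conj (u d) * F (.FBar c d)) *
          ∑ c, ∑ d, conj (u c) * conj (u d) * F (.FBar c d)) := by
    simp only [boseKer, hs, hF, Fin.sum_univ_two, map_add, map_mul, Complex.conj_conj]
    ring
  -- The blocks of $\phi$ and $\phi^*$ are treated together, because $[\phi,\phi]$ and
  -- $[\phi^*,\phi^*]$ couple them.
  have hS : (∑ i, ∑ j, ((∑ l, ∑ m, boseKer (modeKer k) (.phiBar i j) (.phi l m)
        (testConj (f (.phi i j))) (f (.phi l m))) +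
      ∑ l, ∑ m, boseKer (modeKer k) (.phiBar i j) (.phiBar l m)
        (testConj (f (.phi i j))) (f (.phiBar l m)))) +
      (∑ i, ∑ j, ((∑ l, ∑ m, boseKer (modeKer k) (.phi i j) (.phi l m)
        (testConj (f (.phiBar i j))) (f (.phi l m))) +
      ∑ l, ∑ m, boseKer (modeKer k) (.phi i j) (.phiBar l m)
        (testConj (f (.phiBar i j))) (f (.phiBar l m)))) =
      modeWeight k * ((1 / 2) * ∑ i, ∑ j,
        conj (F (.phi i j) - F (.phi j i) + ∑ l, ∑ m, eps4 i j l m * F (.phiBar l m)) *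
      (F (.phi i j) - F (.phi j i) + ∑ l, ∑ m, eps4 i j l m * F (.phiBar l m))) := by
    rw [← scalar_quadratic_form (fun i j => F (.phi i j)) (fun i j => F (.phiBar i j))]
    simp only [Finset.mul_sum, ← Finset.sum_add_distrib, mul_add]
    refine Finset.sum_congr rfl fun _ _ => Finset.sum_congr rfl fun _ _ =>
      Finset.sum_congr rfl fun _ _ => Finset.sum_congr rfl fun _ _ => ?_
    simp only [boseKer, modeKer_testConj, hF, ← mul_assoc]
    simp only [mul_right_comm _ _ Complex.I, neg_mul, Complex.I_mul_I, neg_neg, one_mul]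
    ring
  have hw := modeWeight_nonneg k
  have h4 : (0 : ℂ) ≤ 4 * modeWeight k := mul_nonneg zero_le_four hw
  have z1 (i j : Fin 4) (a b : Fin 2) (x y : Test) :
      boseKer (modeKer k) (.phi i j) (.F a b) x y = 0 := rfl
  have z2 (i j : Fin 4) (a b : Fin 2) (x y : Test) :
      boseKer (modeKer k) (.phi i j) (.FBar a b) x y = 0 := rfl
  have z3 (i j : Fin 4) (a b : Fin 2) (x y : Test) :
      boseKer (modeKer k) (.phiBar i j) (.F a b) x y = 0 := rfl
  have z4 (i j : Fin 4) (a b : Fin 2) (x y : Test) :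
      boseKer (modeKer k) (.phiBar i j) (.FBar a b) x y = 0 := rfl
  have z5 (i j : Fin 4) (a b : Fin 2) (x y : Test) :
      boseKer (modeKer k) (.F a b) (.phi i j) x y = 0 := rfl
  have z6 (i j : Fin 4) (a b : Fin 2) (x y : Test) :
      boseKer (modeKer k) (.FBar a b) (.phi i j) x y = 0 := rfl
  have z7 (i j : Fin 4) (a b : Fin 2) (x y : Test) :
      boseKer (modeKer k) (.F a b) (.phiBar i j) x y = 0 := rfl
  have z8 (i j : Fin 4) (a b : Fin 2) (x y : Test) :
      boseKer (modeKer k) (.FBar a b) (.phiBar i j) x y = 0 := rfl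
  have z9 (a b c d : Fin 2) (x y : Test) :
      boseKer (modeKer k) (.F a b) (.F c d) x y = 0 := rfl
  have z10 (a b c d : Fin 2) (x y : Test) :
      boseKer (modeKer k) (.FBar a b) (.FBar c d) x y = 0 := rfl
  rw [sum_boseField]
  simp only [sum_boseField, BoseField.bar, z1, z2, z3, z4, z5, z6, z7, z8, z9, z10,
    Finset.sum_const_zero, add_zero, zero_add, hF1, hF2]
  rw [hS]
  refine add_nonneg (add_nonneg (mul_nonneg hw (mul_nonneg (div_nonneg zero_le_one zero_le_two) ?_)) ?_) ?_
  · exact Finset.sum_nonneg fun _ _ => Finset.sum_nonneg fun _ _ => conj_mul_self_nonneg _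
  · exact mul_nonneg h4 (conj_mul_self_nonneg _)
  · exact mul_nonneg h4 (conj_mul_self_nonneg _)

end

/-! ### The tensor field -/

lemma pauli2_eq (μ ν : Fin 4) (a b : Fin 2) : pauli2 μ ν a b = Complex.I / 4 *
    (pauli μ a 1 * pauli ν b 0 - pauli ν a 1 * pauli μ b 0 -
      (pauli μ a 0 * pauli ν b 1 - pauli ν a 0 * pauli μ b 1)) := by
  simp only [pauli2, epsUp, Fin.sum_univ_two, Matrix.of_apply, Matrix.cons_val_zero, Matrix.cons_val_one]
  ring
-- Each factor $\epsilon$ has a single nonzero entry per column: it flips the spinor index and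
-- contributes a sign.
lemma tensorCoeff_eq (μ ν : Fin 4) (c d : Fin 2) : tensorCoeff μ ν c d =
    metric μ μ * metric ν ν * (-(1 / 2) * (-1) ^ (c.val + d.val) * pauli2 μ ν (1 - c) (1 - d)) := by
  have h : ∀ c : Fin 2, c = 0 ∨ c = 1 := by decide
  rcases h c with rfl | rfl <;> rcases h d with rfl | rfl <;> 
  simp [tensorCoeff, epsUp, Fin.sum_univ_two]
/-- The coefficients of `F_{cd}` in `F_{μν}`. -/
noncomputable def halfCoeff (p : Fin 4 × Fin 4) (x : Fin 2 × Fin 2) : ℂ :=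
  Complex.I / 2 * tensorCoeff p.1 p.2 x.1 x.2

lemma metric_self (μ : Fin 4) : metric μ μ = if μ = 0 then 1 else -1 := by simp [metric]


lemma halfCoeff_antisymm (μ ν : Fin 4) (x : Fin 2 × Fin 2) :
    halfCoeff (μ, ν) x = -halfCoeff (ν, μ) x := by
  simp only [halfCoeff, tensorCoeff_eq, pauli2_eq]
  ring

/-- This and the next five tables give the independent components. The coefficients for
$(23),(31),(12)$ are $-i$ times those for $(01),(02),(03)$, which is the (anti-)self-duality behind
the inversion formulas. -/
lemma halfCoeff_zero_one (c d : Fin 2) :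
    halfCoeff (0, 1) (c, d) = !![-1, 0; 0, 1] c d / 8 := by
  rw [halfCoeff, tensorCoeff_eq, pauli2_eq, metric_self, metric_self]
  fin_cases c <;> fin_cases d <;> simp [pauli] <;> ring_nf <;> simp <;> ring

lemma halfCoeff_zero_two (c d : Fin 2) :
    halfCoeff (0, 2) (c, d) = !![-Complex.I, 0; 0, -Complex.I] c d / 8 := by
  rw [halfCoeff, tensorCoeff_eq, pauli2_eq, metric_self, metric_self]
  fin_cases c <;> fin_cases d <;> simp [pauli] <;> ring_nf <;> simp <;> ring

lemma halfCoeff_zero_three (c d : Fin 2) :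
    halfCoeff (0, 3) (c, d) = !![0, 1; 1, 0] c d / 8 := by
  rw [halfCoeff, tensorCoeff_eq, pauli2_eq, metric_self, metric_self]
  fin_cases c <;> fin_cases d <;> simp [pauli] <;> ring_nf <;> simp <;> ring

lemma halfCoeff_one_two (c d : Fin 2) :
    halfCoeff (1, 2) (c, d) = !![0, -Complex.I; -Complex.I, 0] c d / 8 := by
  rw [halfCoeff, tensorCoeff_eq, pauli2_eq, metric_self, metric_self]
  fin_cases c <;> fin_cases d <;> simp [pauli] <;> ring_nf <;> simp <;> ring

lemma halfCoeff_one_three (c d : Fin 2) :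
    halfCoeff (1, 3) (c, d) = !![1, 0; 0, 1] c d / 8 := by
  rw [halfCoeff, tensorCoeff_eq, pauli2_eq, metric_self, metric_self]
  fin_cases c <;> fin_cases d <;> simp [pauli] <;> ring_nf <;> simp <;> ring

lemma halfCoeff_two_three (c d : Fin 2) :
    halfCoeff (2, 3) (c, d) = !![Complex.I, 0; 0, -Complex.I] c d / 8 := by
  rw [halfCoeff, tensorCoeff_eq, pauli2_eq, metric_self, metric_self]
  fin_cases c <;> fin_cases d <;> simp [pauli] <;> ring_nf <;> simp <;> ring


lemma halfCoeff_self (μ : Fin 4) (x : Fin 2 × Fin 2) : halfCoeff (μ, μ) x = 0 :=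
  self_eq_neg.1 (halfCoeff_antisymm μ μ x)

/-- The coefficients of `F_{μν}` in `F_{cd}`. -/
noncomputable def recoverCoeff (x : Fin 2 × Fin 2) (p : Fin 4 × Fin 4) : ℂ :=
  8 * metric p.1 p.1 * metric p.2 p.2 * (-1) ^ (x.1.val + x.2.val) * halfCoeff p (1 - x.1, 1 - x.2)

lemma sum_metric_mul_antisymm (X : Fin 4 × Fin 4 → ℂ) (hX : ∀ μ, X (μ, μ) = 0)
    (hX' : ∀ μ ν, X (μ, ν) = X (ν, μ)) :
    ∑ p, metric p.1 p.1 * metric p.2 p.2 * X p =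
      2 * (X (1, 2) + X (1, 3) + X (2, 3) - X (0, 1) - X (0, 2) - X (0, 3)) := by
  simp only [Fintype.sum_prod_type, Fin.sum_univ_four, metric_self, hX, hX' 1 0, hX' 2 0, hX' 3 0,
    hX' 2 1, hX' 3 1, hX' 3 2]
  simp
  ring

/-- By duality the spatial components double the contribution of the mixed ones. The result is the
symmetrizer and not the identity, as only the symmetric part of $F_{ab}$ enters. -/
lemma sum_recoverCoeff_mul_halfCoeff (x y : Fin 2 × Fin 2) :
    ∑ p, recoverCoeff x p * halfCoeff p y =
      ((if x = y then 1 else 0) + (if x = y.swap then 1 else 0)) / 2 := by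
  have h := sum_metric_mul_antisymm (fun p => 8 * (-1) ^ (x.1.val + x.2.val) *
      halfCoeff p (1 - x.1, 1 - x.2) * halfCoeff p y) (fun μ => by rw [halfCoeff_self]; ring)
    (fun μ ν => by rw [halfCoeff_antisymm μ ν, halfCoeff_antisymm μ ν]; ring)
  have hI := Complex.I_sq
  have e : ∑ p, recoverCoeff x p * halfCoeff p y = ∑ p, metric p.1 p.1 * metric p.2 p.2 *
      (8 * (-1) ^ (x.1.val + x.2.val) * halfCoeff p (1 - x.1, 1 - x.2) * halfCoeff p y) := by
    refine Finset.sum_congr rfl fun p _ => ?_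
    rw [recoverCoeff]; ring
  rw [e, h]
  obtain ⟨a, b⟩ := x
  obtain ⟨c, d⟩ := y
  simp only [halfCoeff_zero_one, halfCoeff_zero_two, halfCoeff_zero_three, halfCoeff_one_two,
    halfCoeff_one_three, halfCoeff_two_three]
  fin_cases a <;> fin_cases b <;> fin_cases c <;> fin_cases d <;> simp <;> ring_nf <;>
    (try simp only [hI]) <;> ring_nf

/-- With one factor conjugated, $(-i)\overline{(-i)}=1$, so spatial and mixed components cancel
through the signs of the metric. -/
lemma sum_recoverCoeff_mul_conj_halfCoeff (x y : Fin 2 × Fin 2) :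
    ∑ p, recoverCoeff x p * conj (halfCoeff p y) = 0 := by
  have h := sum_metric_mul_antisymm (fun p => 8 * (-1) ^ (x.1.val + x.2.val) *
      halfCoeff p (1 - x.1, 1 - x.2) * conj (halfCoeff p y))
    (fun μ => by rw [halfCoeff_self]; ring)
    (fun μ ν => by rw [halfCoeff_antisymm μ ν, halfCoeff_antisymm μ ν, map_neg]; ring)
  have hI := Complex.I_sq
  have e : ∑ p, recoverCoeff x p * conj (halfCoeff p y) = ∑ p, metric p.1 p.1 * metric p.2 p.2 *
      (8 * (-1) ^ (x.1.val + x.2.val) * halfCoeff p (1 - x.1, 1 - x.2) * conj (halfCoeff p y)) := by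
    refine Finset.sum_congr rfl fun p _ => ?_
    rw [recoverCoeff]; ring
  have h8 : conj (8 : ℂ) = 8 := Complex.conj_ofNat 8
  rw [e, h]
  obtain ⟨a, b⟩ := x
  obtain ⟨c, d⟩ := y
  simp only [halfCoeff_zero_one, halfCoeff_zero_two, halfCoeff_zero_three, halfCoeff_one_two,
    halfCoeff_one_three, halfCoeff_two_three]
  fin_cases a <;> fin_cases b <;> fin_cases c <;> fin_cases d <;> simp [h8] <;> ring_nf <;>
    (try simp only [hI]) <;> ring_nf

lemma eq_of_antisymm {X Y : Fin 4 → Fin 4 → ℂ} (hX : ∀ μ ν, X μ ν = -X ν μ)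
    (hY : ∀ μ ν, Y μ ν = -Y ν μ) (h01 : X 0 1 = Y 0 1) (h02 : X 0 2 = Y 0 2)
    (h03 : X 0 3 = Y 0 3) (h12 : X 1 2 = Y 1 2) (h13 : X 1 3 = Y 1 3) (h23 : X 2 3 = Y 2 3)
    (μ ν : Fin 4) : X μ ν = Y μ ν := by
  have hd (μ : Fin 4) : X μ μ = Y μ μ := by
    rw [self_eq_neg.1 (hX μ μ), self_eq_neg.1 (hY μ μ)]
  have h4 : ∀ c : Fin 4, c = 0 ∨ c = 1 ∨ c = 2 ∨ c = 3 := by decide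
  rcases h4 μ with rfl | rfl | rfl | rfl <;> rcases h4 ν with rfl | rfl | rfl | rfl <;>
    first
    | exact hd _
    | assumption
    | (rw [hX, hY]; simp only [h01, h02, h03, h12, h13, h23])

/-- The coefficients of the kernel `spinorKer`, contracted with a tensor. -/
noncomputable def spinorContr (T : Fin 4 → Fin 4 → ℂ) (x y : Fin 2 × Fin 2) : ℂ :=
  ∑ μ, ∑ ν, 2 * Complex.I * (pauli μ x.1 y.1 * pauli ν x.2 y.2 + pauli μ x.1 y.2 * pauli ν x.2 y.1) *
    T μ ν

lemma IsWaveTensor.spinorContr_eq {T : Fin 4 → Fin 4 → ℂ} (hT : IsWaveTensor T) (a b c d : Fin 2) :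
    spinorContr T (a, b) (c, d) =
      4 * Complex.I * ∑ μ, ∑ ν, pauli μ a c * pauli ν b d * T μ ν := by
  have h : spinorContr T (a, b) (c, d) =
      2 * Complex.I * ((∑ μ, ∑ ν, pauli μ a c * pauli ν b d * T μ ν) +
        ∑ μ, ∑ ν, pauli μ a d * pauli ν b c * T μ ν) := by
    simp only [spinorContr, Finset.mul_sum, ← Finset.sum_add_distrib]
    refine Finset.sum_congr rfl fun μ _ => Finset.sum_congr rfl fun ν _ => ?_
    ring
  rw [h, hT.pauli_exchange a b d c]
  ring

-- Here the normalization of `tensorKer` is matched with that of `spinorKer`. Both sides are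
-- antisymmetric in $(\mu,\nu)$ and in $(\rho,\sigma)$, which leaves $6\times6$ components, checked
-- with the symmetry and trace condition of $T$.
set_option maxHeartbeats 4000000 in
lemma IsWaveTensor.tensor_eq_spinor {T : Fin 4 → Fin 4 → ℂ} (hT : IsWaveTensor T)
    (μ ν ρ σ : Fin 4) :
    -(Complex.I / 2) * (metric μ ρ * T ν σ - metric ν ρ * T μ σ
      + metric ν σ * T μ ρ - metric μ σ * T ν ρ) =
    ∑ x, ∑ y, (halfCoeff (μ, ν) x * conj (halfCoeff (ρ, σ) y) +
        conj (halfCoeff (μ, ν) y) * halfCoeff (ρ, σ) x) * spinorContr T x y := by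
  have h0 := hT.trace
  have h1 := hT.symm 1 0
  have h2 := hT.symm 2 0
  have h3 := hT.symm 3 0
  have h4 := hT.symm 2 1
  have h5 := hT.symm 3 1
  have h6 := hT.symm 3 2
  have h8 : conj (8 : ℂ) = 8 := Complex.conj_ofNat 8
  let X (μ ν ρ σ : Fin 4) : ℂ := -(Complex.I / 2) * (metric μ ρ * T ν σ - metric ν ρ * T μ σ
      + metric ν σ * T μ ρ - metric μ σ * T ν ρ)
  let Y (μ ν ρ σ : Fin 4) : ℂ := ∑ x, ∑ y, (halfCoeff (μ, ν) x * conj (halfCoeff (ρ, σ) y) +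
        conj (halfCoeff (μ, ν) y) * halfCoeff (ρ, σ) x) * spinorContr T x y
  have hX (μ ν ρ σ : Fin 4) : X μ ν ρ σ = -X ν μ ρ σ := by ring
  have hX' (μ ν ρ σ : Fin 4) : X μ ν ρ σ = -X μ ν σ ρ := by ring
  have hY (μ ν ρ σ : Fin 4) : Y μ ν ρ σ = -Y ν μ ρ σ := by
    simp only [Y, ← Finset.sum_neg_distrib]
    refine Finset.sum_congr rfl fun x _ => Finset.sum_congr rfl fun y _ => ?_
    rw [halfCoeff_antisymm μ ν, halfCoeff_antisymm μ ν, map_neg]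
    ring
  have hY' (μ ν ρ σ : Fin 4) : Y μ ν ρ σ = -Y μ ν σ ρ := by
    simp only [Y, ← Finset.sum_neg_distrib]
    refine Finset.sum_congr rfl fun x _ => Finset.sum_congr rfl fun y _ => ?_
    rw [halfCoeff_antisymm ρ σ, halfCoeff_antisymm ρ σ, map_neg]
    ring
  change X μ ν ρ σ = Y μ ν ρ σ
  refine eq_of_antisymm (X := fun μ ν => X μ ν ρ σ) (Y := fun μ ν => Y μ ν ρ σ)
    (fun _ _ => hX _ _ _ _) (fun _ _ => hY _ _ _ _) ?_ ?_ ?_ ?_ ?_ ?_ μ ν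
  all_goals
    refine eq_of_antisymm (X := fun ρ σ => X _ _ ρ σ) (Y := fun ρ σ => Y _ _ ρ σ)
      (fun _ _ => hX' _ _ _ _) (fun _ _ => hY' _ _ _ _) ?_ ?_ ?_ ?_ ?_ ?_ ρ σ
  all_goals simp only [X, Y]
  all_goals clear hX hX' hY hY' X Y
  all_goals
    simp [Fintype.sum_prod_type, halfCoeff_zero_one, halfCoeff_zero_two, halfCoeff_zero_three,
      halfCoeff_one_two, halfCoeff_one_three, halfCoeff_two_three, hT.spinorContr_eq, metric,
      pauli, Fin.sum_univ_four, h0, h1, h2, h3, h4, h5, h6, h8]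
    try ring_nf
    try simp only [Complex.I_pow_three]
    try ring_nf

/-! ### Graded commutators and adjoints. -/

section Algebra

variable {V : Type*} [AddCommGroup V] [Module ℂ V]

lemma comm_smul_left (c : ℂ) (A B : Module.End ℂ V) : comm (c • A) B = c • comm A B := by
  simp [comm, smul_sub]

lemma comm_smul_right (c : ℂ) (A B : Module.End ℂ V) : comm A (c • B) = c • comm A B := by
  simp [comm, smul_sub]

lemma comm_neg_left (A B : Module.End ℂ V) : comm (-A) B = -comm A B := by
  simp only [comm]; noncomm_ring

lemma comm_add_left (A A' B : Module.End ℂ V) : comm (A + A') B = comm A B + comm A' B := by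
  simp only [comm]; noncomm_ring

lemma comm_add_right (A B B' : Module.End ℂ V) : comm A (B + B') = comm A B + comm A B' := by
  simp only [comm]; noncomm_ring

lemma comm_zero_right (A : Module.End ℂ V) : comm A 0 = 0 := by simp [comm]

lemma comm_sum_left {ι : Type*} (s : Finset ι) (A : ι → Module.End ℂ V) (B : Module.End ℂ V) :
    comm (∑ i ∈ s, A i) B = ∑ i ∈ s, comm (A i) B := by
  simp [comm, Finset.sum_mul, Finset.mul_sum]

lemma comm_sum_right {ι : Type*} (s : Finset ι) (A : Module.End ℂ V) (B : ι → Module.End ℂ V) :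
    comm A (∑ i ∈ s, B i) = ∑ i ∈ s, comm A (B i) := by
  simp [comm, Finset.sum_mul, Finset.mul_sum]

lemma comm_swap (A B : Module.End ℂ V) : comm B A = -comm A B := by simp [comm]

lemma acomm_smul_left (c : ℂ) (A B : Module.End ℂ V) : acomm (c • A) B = c • acomm A B := by
  simp [acomm, smul_add]

lemma acomm_smul_right (c : ℂ) (A B : Module.End ℂ V) : acomm A (c • B) = c • acomm A B := by
  simp [acomm, smul_add]

lemma acomm_neg_left (A B : Module.End ℂ V) : acomm (-A) B = -acomm A B := by
  simp only [acomm]; noncomm_ring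

lemma acomm_zero_left (A : Module.End ℂ V) : acomm 0 A = 0 := by simp [acomm]

lemma acomm_zero_right (A : Module.End ℂ V) : acomm A 0 = 0 := by simp [acomm]

lemma acomm_sum_left {ι : Type*} (s : Finset ι) (A : ι → Module.End ℂ V) (B : Module.End ℂ V) :
    acomm (∑ i ∈ s, A i) B = ∑ i ∈ s, acomm (A i) B := by
  simp [acomm, Finset.sum_mul, Finset.mul_sum, Finset.sum_add_distrib]

lemma acomm_swap (A B : Module.End ℂ V) : acomm B A = acomm A B := by simp [acomm, add_comm]

/-- The graded Jacobi identity for two odd operators and an even one commuting with one of them. -/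
lemma acomm_comm_of_comm_eq_zero {B ψ : Module.End ℂ V} (h : comm B ψ = 0)
    (q : Module.End ℂ V) : acomm ψ (comm q B) = comm (acomm q ψ) B := by
  have h' : B * ψ = ψ * B := sub_eq_zero.1 h
  simp only [acomm, comm]
  have e : ψ * (q * B - B * q) + (q * B - B * q) * ψ =
    ψ * q * B - (ψ * B) * q + q * (B * ψ) - B * q * ψ := by noncomm_ring
  rw [e, h', ← h']
  noncomm_ring
  rw [← mul_assoc, ← mul_assoc, h']
  noncomm_ring

lemma comm_acomm (X q ψ : Module.End ℂ V) :
    comm X (acomm q ψ) = acomm (comm X q) ψ + acomm q (comm X ψ) := by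
  simp only [acomm, comm]; noncomm_ring

section Adjoint

variable {form : V →ₗ⋆[ℂ] V →ₗ[ℂ] ℂ} {A A' B B' : Module.End ℂ V}

/-- Nondegeneracy upgrades equality of matrix elements to equality of operators; this is how
relations for adjoint fields and $\bar Q$ are derived. -/
lemma IsAdj.unique (hH : ∀ u v, form u v = conj (form v u))
    (hN : ∀ u, (∀ v, form u v = 0) → u = 0) (h : IsAdj form A B) (h' : IsAdj form A B') :
    B = B' := by
  ext v
  rw [← sub_eq_zero]
  refine hN _ fun u => ?_
  rw [hH, map_sub, ← h, ← h', sub_self, map_zero]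

lemma IsAdj.acomm (h : IsAdj form A A') (h' : IsAdj form B B') :
    IsAdj form (acomm A B) (acomm A' B') := by
  intro u v
  simp only [N4.acomm, LinearMap.add_apply, Module.End.mul_apply, map_add, h _ _, h' _ _]
  rw [add_comm]

lemma IsAdj.comm (h : IsAdj form A A') (h' : IsAdj form B B') :
    IsAdj form (comm A B) (comm B' A') := by
  intro u v
  simp only [N4.comm, LinearMap.sub_apply, Module.End.mul_apply, map_sub, h _ _, h' _ _]

lemma IsAdj.smul (h : IsAdj form A A') (c : ℂ) : IsAdj form (c • A) (conj c • A') := by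
  intro u v
  simp [h u v]

lemma IsAdj.neg (h : IsAdj form A A') : IsAdj form (-A) (-A') := by
  intro u v
  simp [h u v]

lemma isAdj_zero : IsAdj form 0 0 := fun u v => by simp

lemma isAdj_sum {ι : Type*} (s : Finset ι) {A A' : ι → Module.End ℂ V}
    (h : ∀ i, IsAdj form (A i) (A' i)) : IsAdj form (∑ i ∈ s, A i) (∑ i ∈ s, A' i) := by
  intro u v
  simp [LinearMap.sum_apply, h _ u v]

end Adjoint

end Algebra

lemma testConj_apply (f : Test) (x : Spacetime) : testConj f x = conj (f x) := rfl

lemma testConj_testConj (f : Test) : testConj (testConj f) = f := by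
  ext x; simp [testConj_apply]

lemma testConj_pd (μ : Fin 4) (f : Test) : testConj (pd μ f) = pd μ (testConj f) := by
  ext x
  rw [testConj_apply, pd, pd, SchwartzMap.lineDerivOp_apply_eq_fderiv,
    SchwartzMap.lineDerivOp_apply_eq_fderiv]
  have h : (testConj f : Spacetime → ℂ) = (Complex.conjCLE : ℂ →L[ℝ] ℂ) ∘ f := rfl
  rw [h, ((Complex.conjCLE : ℂ →L[ℝ] ℂ).hasFDerivAt.comp x (f.hasFDerivAt x)).fderiv]
  rfl

/-- The second and third index of `ε_{plqm}` can be chosen such that only the given `m` survives. -/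
lemma exists_eps4_of_ne {p m : Fin 4} (h : p ≠ m) :
    ∃ l q, ∀ m', eps4 p l q m' = if m' = m then 1 else 0 := by
  have h' : ∀ p m : Fin 4, p ≠ m → ∃ l q : Fin 4, ∀ m' : Fin 4,
      Int.sign ((((l : ℕ) : ℤ) - (p : ℕ)) * (((q : ℕ) : ℤ) - (p : ℕ)) * (((m' : ℕ) : ℤ) - (p : ℕ)) *
        (((q : ℕ) : ℤ) - (l : ℕ)) * (((m' : ℕ) : ℤ) - (l : ℕ)) * (((m' : ℕ) : ℤ) - (q : ℕ))) =
      if m' = m then 1 else 0 := by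
    decide +kernel
  obtain ⟨l, q, hlq⟩ := h' p m h
  refine ⟨l, q, fun m' => ?_⟩
  simp only [eps4, hlq m']
  split_ifs <;> simp

/-- The first index of `ε_{plqm}` can be chosen such that only one `m` survives. -/
lemma exists_eps4_of_ne' {l q : Fin 4} (h : l ≠ q) :
    ∃ p m, p ≠ m ∧ ∀ m', eps4 p l q m' = if m' = m then 1 else 0 := by
  have h' : ∀ l q : Fin 4, l ≠ q → ∃ p m : Fin 4, p ≠ m ∧ ∀ m' : Fin 4,
      Int.sign ((((l : ℕ) : ℤ) - (p : ℕ)) * (((q : ℕ) : ℤ) - (p : ℕ)) * (((m' : ℕ) : ℤ) - (p : ℕ)) *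
        (((q : ℕ) : ℤ) - (l : ℕ)) * (((m' : ℕ) : ℤ) - (l : ℕ)) * (((m' : ℕ) : ℤ) - (q : ℕ))) =
      if m' = m then 1 else 0 := by
    decide +kernel
  obtain ⟨p, m, hpm, hlq⟩ := h' l q h
  refine ⟨p, m, hpm, fun m' => ?_⟩
  simp only [eps4, hlq m']
  split_ifs <;> simp

/-! ### Commutators forced by supersymmetry. -/

namespace Multiplet

variable {V : Type*} [AddCommGroup V] [Module ℂ V] {form : V →ₗ⋆[ℂ] V →ₗ[ℂ] ℂ}
  (M : Multiplet form)

/-- If $[B,\psi]=c$ then $0=[B,\{\psi,\psi\}]=4c\psi$, so either $c=0$ or $\psi=0$; the commutator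
vanishes in both cases. -/
lemma comm_bose_fermi (I : BoseField) (J : FermiField) (f g : Test) :
    comm (M.bose I f) (M.fermi J g) = 0 := by
  obtain ⟨c, hc⟩ := M.free_mixed I J f g
  obtain ⟨d, hd⟩ := M.free_fermi J J g g
  have h := comm_acomm (M.bose I f) (M.fermi J g) (M.fermi J g)
  rw [hd, hc, comm_smul_right] at h
  have h1 : comm (M.bose I f) 1 = 0 := by simp [comm]
  rw [h1, smul_zero, acomm_smul_left, acomm_smul_right] at h
  have h2 : acomm 1 (M.fermi J g) = (2 : ℂ) • M.fermi J g := by simp [acomm, two_smul]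
  have h3 : acomm (M.fermi J g) 1 = (2 : ℂ) • M.fermi J g := by simp [acomm, two_smul]
  rw [h2, h3, ← add_smul, smul_smul] at h
  rcases smul_eq_zero.1 (h.symm.trans rfl) with h | h
  · have : c = 0 := by
      rcases mul_eq_zero.1 h with h | h
      · linear_combination h / 2
      · norm_num at h
    rw [hc, this, zero_smul]
  · rw [h, comm_zero_right]

/-- `λ_{mb}` as a commutator of a supercharge and a scalar. -/
lemma exists_lam_eq {p m : Fin 4} (h : p ≠ m) : ∃ l q, ∀ b g,
    M.fermi (.lam m b) g = Complex.I • comm (M.Q p b) (M.bose (.phi l q) g) := by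
  obtain ⟨l, q, hlq⟩ := exists_eps4_of_ne h
  refine ⟨l, q, fun b g => ?_⟩
  rw [M.Q_phi]
  simp [hlq]

/-- Four internal indices leave a $p$ different from both $j$ and $m$. Then $\lambda_m$ is a
commutator with $Q_p$, while $\{Q_p,\lambda_j\}=0$. -/
lemma acomm_lam_lam (j m : Fin 4) (a b : Fin 2) (f g : Test) :
    acomm (M.fermi (.lam j a) f) (M.fermi (.lam m b) g) = 0 := by
  obtain ⟨p, hpj, hpm⟩ : ∃ p, p ≠ j ∧ p ≠ m := by revert j m; decide
  obtain ⟨l, q, h⟩ := M.exists_lam_eq hpm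
  rw [h, acomm_smul_right, acomm_comm_of_comm_eq_zero (M.comm_bose_fermi _ _ _ _), M.Q_lam]
  simp [kron, hpj, comm]

lemma phi_self (j : Fin 4) (f : Test) : M.bose (.phi j j) f = 0 := by
  have h : (2 : ℂ) • M.bose (.phi j j) f = 0 := by
    rw [two_smul]
    exact eq_neg_iff_add_eq_zero.1 (M.bose_constraints.phi_antisymm j j f)
  exact (smul_eq_zero.1 h).resolve_left two_ne_zero

/-- The Jacobi argument for $\{\lambda_p,\lambda_m\}=0$ is read backwards, with the supercharge
$Q_p$ chosen so that $\{Q_p,\lambda_p\}=F$. -/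
lemma comm_F_phi (a b : Fin 2) (l q : Fin 4) (f g : Test) :
    comm (M.bose (.F a b) f) (M.bose (.phi l q) g) = 0 := by
  rcases eq_or_ne l q with rfl | h
  · rw [phi_self, comm_zero_right]
  obtain ⟨p, m, hpm, hlq⟩ := exists_eps4_of_ne' h
  have h1 : M.fermi (.lam m a) g = Complex.I • comm (M.Q p a) (M.bose (.phi l q) g) := by
    rw [M.Q_phi]; simp [hlq]
  have h2 := M.acomm_lam_lam p m b a f g
  rw [h1, acomm_smul_right, acomm_comm_of_comm_eq_zero (M.comm_bose_fermi _ _ _ _), M.Q_lam] at h2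
  simpa [kron] using h2

lemma phiBar_eq (j k : Fin 4) (f : Test) : M.bose (.phiBar j k) f =
    (1 / 2 : ℂ) • ∑ l, ∑ m, eps4 j k l m • M.bose (.phi l m) f := by
  have h := M.bose_constraints.phi_reality j k f
  rw [h, smul_smul]
  norm_num

lemma comm_F_phiBar (a b : Fin 2) (l q : Fin 4) (f g : Test) :
    comm (M.bose (.F a b) f) (M.bose (.phiBar l q) g) = 0 := by
  rw [phiBar_eq]
  simp [comm_smul_right, comm_sum_right, comm_F_phi]

/-- One factor is $\{Q,\lambda\}$, and the other commutes with both $Q$ and $\lambda$. -/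
lemma comm_F_F (a b c d : Fin 2) (f g : Test) :
    comm (M.bose (.F a b) f) (M.bose (.F c d) g) = 0 := by
  have h : M.bose (.F c d) g = acomm (M.Q 0 c) (M.fermi (.lam 0 d) g) := by
    rw [M.Q_lam]; simp [kron]
  rw [h, comm_acomm, comm_bose_fermi, comm_swap, M.Q_F, neg_zero, acomm_zero_left,
    acomm_zero_right, add_zero]

section Adjoint

variable (hH : ∀ u v, form u v = conj (form v u)) (hN : ∀ u, (∀ v, form u v = 0) → u = 0)

lemma bose_adj' (I : BoseField) (f : Test) :
    IsAdj form (M.bose I (testConj f)) (M.bose I.bar f) := by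
  simpa [testConj_testConj] using M.bose_adj I (testConj f)

lemma fermi_adj' (I : FermiField) (f : Test) :
    IsAdj form (M.fermi I (testConj f)) (M.fermi I.bar f) := by
  simpa [testConj_testConj] using M.fermi_adj I (testConj f)

include hH hN

lemma comm_bar_bar {I J : BoseField} (h : ∀ f g, comm (M.bose I f) (M.bose J g) = 0)
    (f g : Test) : comm (M.bose I.bar f) (M.bose J.bar g) = 0 := by
  have h1 := (M.bose_adj' I f).comm (M.bose_adj' J g)
  rw [h] at h1
  rw [comm_swap, h1.unique hH hN isAdj_zero, neg_zero]

lemma acomm_lamBar_lamBar (j m : Fin 4) (a b : Fin 2) (f g : Test) :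
    acomm (M.fermi (.lamBar j a) f) (M.fermi (.lamBar m b) g) = 0 := by
  have h1 := (M.fermi_adj' (.lam j a) f).acomm (M.fermi_adj' (.lam m b) g)
  rw [acomm_lam_lam] at h1
  exact h1.unique hH hN isAdj_zero

lemma Qbar_lamBar (j k : Fin 4) (a b : Fin 2) (f : Test) :
    acomm (M.Qbar j a) (M.fermi (.lamBar k b) f) = kron j k • M.bose (.FBar a b) f := by
  have h1 := (M.Q_adj j a).acomm (M.fermi_adj' (.lam k b) f)
  rw [M.Q_lam] at h1
  have hk : conj (kron j k) = kron j k := by simp [kron, apply_ite]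
  rw [← hk]
  exact h1.unique hH hN ((M.bose_adj' (.F a b) f).smul _)

lemma Qbar_lam (j k : Fin 4) (a b : Fin 2) (f : Test) :
    acomm (M.Qbar j a) (M.fermi (.lam k b) f) =
      ∑ μ, (2 * pauli μ b a) • -M.bose (.phiBar j k) (pd μ f) := by
  have h1 := (M.Q_adj j a).acomm (M.fermi_adj' (.lamBar k b) f)
  rw [M.Q_lamBar] at h1
  have h2 : IsAdj form
      (∑ μ, (2 * pauli μ a b) • distDeriv μ (M.bose (.phi j k)) (testConj f))
      (∑ μ, conj (2 * pauli μ a b) • -M.bose (.phiBar j k) (pd μ f)) := by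
    refine isAdj_sum _ fun μ => IsAdj.smul (IsAdj.neg ?_) _
    rw [← testConj_pd]
    exact M.bose_adj' (.phi j k) (pd μ f)
  have h3 := h1.unique hH hN h2
  simp only [map_mul, conj_pauli, Complex.conj_ofNat] at h3
  exact h3

lemma acomm_lam_lamBar {D : Test → Test → ℂ}
    (h : ∀ j k l m f g, comm (M.bose (.phiBar j k) f) (M.bose (.phi l m) g) =
      (-Complex.I * (kron j l * kron k m - kron j m * kron k l) * D f g) • 1)
    (j l : Fin 4) (a b : Fin 2) (f g : Test) :
    acomm (M.fermi (.lam j a) f) (M.fermi (.lamBar l b) g) =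
      fermiKer D (.lam j a) (.lamBar l b) f g • 1 := by
  -- With $k\ne l$ one has $\bar\lambda_l=i[\bar Q_k,\phi_{kl}]$, and $\{\bar Q_k,\lambda_j\}$ is a
  -- derivative of $\phi^*_{kj}$; only $\delta_{kk}\delta_{jl}$ survives in
  -- $[\phi^*_{kj},\phi_{kl}]$.
  obtain ⟨k, hk⟩ : ∃ k, k ≠ l := by revert l; decide
  have h1 : M.fermi (.lamBar l b) g = Complex.I • comm (M.Qbar k b) (M.bose (.phi k l) g) := by
    rw [M.Qbar_phi]; simp [kron, hk]
  rw [h1, acomm_smul_right, acomm_comm_of_comm_eq_zero (M.comm_bose_fermi _ _ _ _),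
    M.Qbar_lam hH hN]
  simp only [comm_sum_left, comm_smul_left, comm_neg_left, h, fermiKer, dKer_apply, Finset.smul_sum,
    Finset.sum_smul, smul_smul, ← neg_smul]
  refine Finset.sum_congr rfl fun μ _ => ?_
  congr 1
  have : kron k k = 1 := by simp [kron]
  have h' : kron k l = 0 := by simp [kron, hk]
  rw [this, h']
  linear_combination (2 * pauli μ a b * kron j l * D (pd μ f) g) * Complex.I_sq

lemma comm_F_FBar {D : Test → Test → ℂ} (hD : IsWaveKernel D)
    (h : ∀ j k l m f g, comm (M.bose (.phiBar j k) f) (M.bose (.phi l m) g) =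
      (-Complex.I * (kron j l * kron k m - kron j m * kron k l) * D f g) • 1)
    (a b c d : Fin 2) (f g : Test) :
    comm (M.bose (.F a b) f) (M.bose (.FBar c d) g) = spinorKer D a b c d f g • 1 := by
  have h1 : M.bose (.FBar c d) g = acomm (M.Qbar 0 c) (M.fermi (.lamBar 0 d) g) := by
    rw [M.Qbar_lamBar hH hN]; simp [kron]
  have hT := hD.isWaveTensor f g
  -- The Leibniz rule for $F^*=\{\bar Q_0,\bar\lambda_0\}$ produces a single product $\sigma\sigma$
  -- with coefficient $4i$; by the wave equation it equals the symmetrized kernel.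
  have hs : spinorKer D a b c d f g =
      4 * Complex.I * ∑ μ, ∑ ν, pauli μ b c * pauli ν a d * ddKer D μ ν f g := by
    have := hT.spinorContr_eq a b c d
    rw [hT.pauli_exchange, hT.pauli_swap] at this
    exact this
  rw [h1, comm_acomm, comm_bose_fermi, comm_swap, M.Qbar_F, acomm_zero_right, add_zero, hs]
  simp only [distDeriv, acomm_neg_left, acomm_sum_left, acomm_smul_left,
    M.acomm_lam_lamBar hH hN h, fermiKer, dKer_apply, ddKer_apply, Finset.mul_sum, Finset.sum_smul,
    Finset.smul_sum, smul_smul, ← neg_smul, ← Finset.sum_neg_distrib]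
  refine Finset.sum_congr rfl fun μ _ => Finset.sum_congr rfl fun ν _ => ?_
  congr 1
  simp [kron]
  ring

end Adjoint

end Multiplet

/-! ### Passage between $F_{ab}$ and $F_{\mu\nu}$, and the complete tables. -/

lemma sum_symmetrizer {W : Type*} [AddCommGroup W] [Module ℂ W] (x : Fin 2 × Fin 2)
    (G : Fin 2 × Fin 2 → W) (hG : ∀ y, G y.swap = G y) :
    ∑ y, (((if x = y then 1 else 0) + (if x = y.swap then 1 else 0)) / 2 : ℂ) • G y = G x := by
  have h (y : Fin 2 × Fin 2) : (x = y.swap) ↔ (x.swap = y) := by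
    rw [← Prod.swap_inj, Prod.swap_swap]
  simp only [h, add_div, add_smul, Finset.sum_add_distrib]
  simp only [ite_div, zero_div, ite_smul, zero_smul, Finset.sum_ite_eq, Finset.mem_univ, if_true, hG]
  rw [← add_smul]
  norm_num

namespace Multiplet

variable {V : Type*} [AddCommGroup V] [Module ℂ V] {form : V →ₗ⋆[ℂ] V →ₗ[ℂ] ℂ}
  (M : Multiplet form)

lemma tensorF_eq (p : Fin 4 × Fin 4) (f : Test) : M.tensorF p.1 p.2 f =
    (∑ x, halfCoeff p x • M.bose (.F x.1 x.2) f) +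
      ∑ x, conj (halfCoeff p x) • M.bose (.FBar x.1 x.2) f := by
  -- Conjugating $i/2$ absorbs the minus sign in the definition of $F_{\mu\nu}$, so the coefficients
  -- of $F^*$ are the conjugates of those of $F$.
  have h (x : Fin 2 × Fin 2) : conj (halfCoeff p x) =
      -(Complex.I / 2 * conj (tensorCoeff p.1 p.2 x.1 x.2)) := by
    rw [halfCoeff, map_mul, map_div₀, Complex.conj_I, Complex.conj_ofNat]; ring
  simp only [h]
  rw [tensorF, smul_sub]
  simp only [halfCoeff, Fintype.sum_prod_type, Finset.smul_sum, smul_smul,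
    neg_smul, Finset.sum_neg_distrib, sub_eq_add_neg]

lemma F_eq_sum_tensorF (x : Fin 2 × Fin 2) (f : Test) :
    M.bose (.F x.1 x.2) f = ∑ p, recoverCoeff x p • M.tensorF p.1 p.2 f := by
  simp only [tensorF_eq, smul_add, Finset.smul_sum, smul_smul, Finset.sum_add_distrib]
  rw [Finset.sum_comm, Finset.sum_comm (γ := Fin 4 × Fin 4)]
  simp only [← Finset.sum_smul, sum_recoverCoeff_mul_halfCoeff,
    sum_recoverCoeff_mul_conj_halfCoeff, zero_smul, Finset.sum_const_zero, add_zero]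
  exact (sum_symmetrizer x (fun y => M.bose (.F y.1 y.2) f)
    fun y => M.bose_constraints.F_symm _ _ f).symm

lemma FBar_eq_sum_tensorF (x : Fin 2 × Fin 2) (f : Test) :
    M.bose (.FBar x.1 x.2) f = ∑ p, conj (recoverCoeff x p) • M.tensorF p.1 p.2 f := by
  have h1 (y : Fin 2 × Fin 2) : ∑ p, conj (recoverCoeff x p) * conj (halfCoeff p y) =
      ((if x = y then 1 else 0) + (if x = y.swap then 1 else 0)) / 2 := by
    simp only [← map_mul, ← map_sum, sum_recoverCoeff_mul_halfCoeff]
    split_ifs <;> simp [Complex.conj_ofNat 2]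
  have h2 (y : Fin 2 × Fin 2) : ∑ p, conj (recoverCoeff x p) * halfCoeff p y = 0 := by
    have := congrArg conj (sum_recoverCoeff_mul_conj_halfCoeff x y)
    simpa using this
  simp only [tensorF_eq, smul_add, Finset.smul_sum, smul_smul, Finset.sum_add_distrib]
  rw [Finset.sum_comm, Finset.sum_comm (γ := Fin 4 × Fin 4)]
  simp only [← Finset.sum_smul, h1, h2, zero_smul, Finset.sum_const_zero, zero_add]
  exact (sum_symmetrizer x (fun y => M.bose (.FBar y.1 y.2) f)
    fun y => M.bose_constraints.FBar_symm _ _ f).symm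

lemma comm_FBar_FBar (hH : ∀ u v, form u v = conj (form v u))
    (hN : ∀ u, (∀ v, form u v = 0) → u = 0) (a b c d : Fin 2) (f g : Test) :
    comm (M.bose (.FBar a b) f) (M.bose (.FBar c d) g) = 0 :=
  M.comm_bar_bar hH hN (I := .F a b) (J := .F c d) (M.comm_F_F a b c d) f g

lemma comm_tensorF_of_spinor {D : Test → Test → ℂ} (hD : IsWaveKernel D)
    (hanti : ∀ f g, D g f = -D f g)
    (hH : ∀ u v, form u v = conj (form v u)) (hN : ∀ u, (∀ v, form u v = 0) → u = 0)
    (h : ∀ a b c d f g, comm (M.bose (.F a b) f) (M.bose (.FBar c d) g) =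
      spinorKer D a b c d f g • 1) (μ ν ρ σ : Fin 4) (f g : Test) :
    comm (M.tensorF μ ν f) (M.tensorF ρ σ g) = tensorKer D μ ν ρ σ f g • 1 := by
  have h' (a b c d : Fin 2) : comm (M.bose (.FBar c d) f) (M.bose (.F a b) g) =
      spinorKer D a b c d f g • 1 := by
    have := boseKer_swap hD hanti (.F a b) (.FBar c d) f g
    simp only [boseKer] at this
    rw [comm_swap, h, ← neg_smul, this, neg_neg]
  have hT : tensorKer D μ ν ρ σ f g = ∑ x, ∑ y, (halfCoeff (μ, ν) x * conj (halfCoeff (ρ, σ) y) +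
        conj (halfCoeff (μ, ν) y) * halfCoeff (ρ, σ) x) * spinorKer D x.1 x.2 y.1 y.2 f g :=
    (hD.isWaveTensor f g).tensor_eq_spinor μ ν ρ σ
  rw [M.tensorF_eq (μ, ν), M.tensorF_eq (ρ, σ), hT]
  simp only [comm_add_left, comm_add_right, comm_sum_left, comm_sum_right, comm_smul_left,
    comm_smul_right, M.comm_F_F, M.comm_FBar_FBar hH hN, h, h', smul_zero, Finset.sum_const_zero,
    zero_add, add_zero, Finset.smul_sum, smul_smul, Finset.sum_smul, add_mul, add_smul, Finset.sum_add_distrib]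
  rw [add_comm]
  congr 1
  · rw [Finset.sum_comm]
    refine Finset.sum_congr rfl fun x _ => Finset.sum_congr rfl fun y _ => ?_
    congr 1
    ring
  · refine Finset.sum_congr rfl fun x _ => Finset.sum_congr rfl fun y _ => ?_
    congr 1
    ring

/-- Both fields are recovered from $F_{\mu\nu}$, and the resulting numerical contraction of
`tensorKer` collapses: one of the two terms in `tensor_eq_spinor` is annihilated, the other is only
symmetrized, and `spinorKer` is already symmetric. -/
lemma comm_spinor_of_tensorF {D : Test → Test → ℂ} (hD : IsWaveKernel D)
    (h : ∀ μ ν ρ σ f g, comm (M.tensorF μ ν f) (M.tensorF ρ σ g) =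
      tensorKer D μ ν ρ σ f g • 1) (a b c d : Fin 2) (f g : Test) :
    comm (M.bose (.F a b) f) (M.bose (.FBar c d) g) = spinorKer D a b c d f g • 1 := by
  have hF := M.F_eq_sum_tensorF (a, b) f
  have hFB := M.FBar_eq_sum_tensorF (c, d) g
  simp only at hF hFB
  rw [hF, hFB]
  simp only [comm_sum_left, comm_sum_right, comm_smul_left, comm_smul_right, h, smul_smul,
    ← Finset.sum_smul]
  congr 1
  set S : Fin 2 × Fin 2 → Fin 2 × Fin 2 → ℂ := fun x y => spinorKer D x.1 x.2 y.1 y.2 f g with hS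
  have hT (p q : Fin 4 × Fin 4) : tensorKer D p.1 p.2 q.1 q.2 f g =
      ∑ x, ∑ y, (halfCoeff p x * conj (halfCoeff q y) +
        conj (halfCoeff p y) * halfCoeff q x) * S x y :=
    (hD.isWaveTensor f g).tensor_eq_spinor p.1 p.2 q.1 q.2
  have hS1 (x y : Fin 2 × Fin 2) : S x.swap y = S x y := hD.spinorKer_symm _ _ _ _ f g
  have hS2 (x y : Fin 2 × Fin 2) : S x y.swap = S x y := spinorKer_symm_right D _ _ _ _ f g
  have hr (x : Fin 2 × Fin 2) : ∑ q, conj (recoverCoeff (c, d) q) * conj (halfCoeff q x) =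
      ((if (c, d) = x then 1 else 0) + (if (c, d) = x.swap then 1 else 0)) / 2 := by
    simp only [← map_mul, ← map_sum, sum_recoverCoeff_mul_halfCoeff]
    split_ifs <;> simp [Complex.conj_ofNat 2]
  have hp (q : Fin 4 × Fin 4) : ∑ p, recoverCoeff (a, b) p * tensorKer D p.1 p.2 q.1 q.2 f g =
      ∑ y, conj (halfCoeff q y) * S (a, b) y := by
    have e : ∑ p, recoverCoeff (a, b) p * tensorKer D p.1 p.2 q.1 q.2 f g =
        ∑ y, ∑ x, ((∑ p, recoverCoeff (a, b) p * halfCoeff p x) • (conj (halfCoeff q y) * S x y) +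
          (∑ p, recoverCoeff (a, b) p * conj (halfCoeff p y)) * (halfCoeff q x * S x y)) := by
      simp only [hT, smul_eq_mul, Finset.mul_sum, Finset.sum_mul, ← Finset.sum_add_distrib]
      rw [Finset.sum_comm_cycle]
      refine Finset.sum_congr rfl fun y _ => ?_
      rw [Finset.sum_comm]
      refine Finset.sum_congr rfl fun x _ => Finset.sum_congr rfl fun p _ => ?_
      ring
    rw [e]
    simp only [sum_recoverCoeff_mul_halfCoeff, sum_recoverCoeff_mul_conj_halfCoeff, zero_mul,
      add_zero]
    refine Finset.sum_congr rfl fun y _ => ?_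
    exact sum_symmetrizer (a, b) (fun x => conj (halfCoeff q y) * S x y) fun x => by rw [hS1]
  have hq : ∑ q, conj (recoverCoeff (c, d) q) * ∑ y, conj (halfCoeff q y) * S (a, b) y =
      S (a, b) (c, d) := by
    simp only [Finset.mul_sum, ← mul_assoc]
    rw [Finset.sum_comm]
    simp only [← Finset.sum_mul, hr]
    exact sum_symmetrizer (c, d) (fun y => S (a, b) y) fun y => hS2 _ _
  rw [show spinorKer D a b c d f g = S (a, b) (c, d) from rfl, ← hq]
  simp only [← hp, Finset.mul_sum]

/-- The commutator of the scalars and their adjoints determines all other (anti)commutators. -/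
lemma comm_bose_bose {D : Test → Test → ℂ} (hD : IsWaveKernel D) (hanti : ∀ f g, D g f = -D f g)
    (hH : ∀ u v, form u v = conj (form v u)) (hN : ∀ u, (∀ v, form u v = 0) → u = 0)
    (h : ∀ j k l m f g, comm (M.bose (.phi j k) f) (M.bose (.phiBar l m) g) =
      boseKer D (.phi j k) (.phiBar l m) f g • 1) (I J : BoseField) (f g : Test) :
    comm (M.bose I f) (M.bose J g) = boseKer D I J f g • 1 := by
  have hswap {I J : BoseField} {f g : Test}
      (h : comm (M.bose I f) (M.bose J g) = boseKer D I J f g • 1) :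
      comm (M.bose J g) (M.bose I f) = boseKer D J I g f • 1 := by
    rw [comm_swap, h, boseKer_swap hD hanti, neg_smul, neg_neg]
  have hbp (j k l m : Fin 4) (f g : Test) : comm (M.bose (.phiBar j k) f) (M.bose (.phi l m) g) =
      boseKer D (.phiBar j k) (.phi l m) f g • 1 := hswap (h _ _ _ _ _ _)
  have hbb (j k l m : Fin 4) (f g : Test) :
      comm (M.bose (.phiBar j k) f) (M.bose (.phiBar l m) g) =
      boseKer D (.phiBar j k) (.phiBar l m) f g • 1 := by
    -- The reality relation holds both for the operators and for the table, so $[\phi^*,\phi^*]$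
    -- follows from $[\phi,\phi^*]$; the same device gives $[\phi,\phi]$ below.
    have e := (boseConstraints_boseKer hD (.phiBar l m) g).phi_reality j k f
    rw [M.phiBar_eq j k]
    simp only [comm_smul_left, comm_sum_left, h, smul_smul, ← Finset.sum_smul]
    simp only [smul_eq_mul] at e
    rw [e]
    norm_num [← mul_assoc]
  have hpp (j k l m : Fin 4) (f g : Test) :
      comm (M.bose (.phi j k) f) (M.bose (.phi l m) g) =
      boseKer D (.phi j k) (.phi l m) f g • 1 := by
    have e := (boseConstraints_boseKer hD (.phi l m) g).phiBar_reality j k f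
    have e' : M.bose (.phi j k) f =
        (1 / 2 : ℂ) • ∑ l, ∑ m, eps4 j k l m • M.bose (.phiBar l m) f := by
      have h := M.bose_constraints.phiBar_reality j k f
      rw [h, smul_smul]
      norm_num
    rw [e']
    simp only [comm_smul_left, comm_sum_left, hbp, smul_smul, ← Finset.sum_smul]
    simp only [smul_eq_mul] at e
    rw [e]
    norm_num [← mul_assoc]
  have hFF := M.comm_F_FBar hH hN hD hbp
  have z (a b : Fin 2) (j k : Fin 4) (f g : Test) :
      comm (M.bose (.FBar a b) f) (M.bose (.phi j k) g) = 0 :=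
    M.comm_bar_bar hH hN (I := .F a b) (J := .phiBar j k) (M.comm_F_phiBar a b j k) f g
  have z' (a b : Fin 2) (j k : Fin 4) (f g : Test) :
      comm (M.bose (.FBar a b) f) (M.bose (.phiBar j k) g) = 0 :=
    M.comm_bar_bar hH hN (I := .F a b) (J := .phi j k) (M.comm_F_phi a b j k) f g
  have h0 {I J : BoseField} (e : boseKer D I J f g = 0)
      (h : comm (M.bose I f) (M.bose J g) = 0) :
      comm (M.bose I f) (M.bose J g) = boseKer D I J f g • 1 := by rw [h, e, zero_smul]
  have h0' {I J : BoseField} (e : boseKer D I J f g = 0)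
      (h : comm (M.bose J g) (M.bose I f) = 0) :
      comm (M.bose I f) (M.bose J g) = boseKer D I J f g • 1 := by
    rw [comm_swap, h, e, zero_smul, neg_zero]
  cases I with
  | phi j k => cases J with
    | phi l m => exact hpp _ _ _ _ _ _
    | phiBar l m => exact h _ _ _ _ _ _
    | F a b => exact h0' rfl (M.comm_F_phi _ _ _ _ _ _)
    | FBar a b => exact h0' rfl (z _ _ _ _ _ _)
  | phiBar j k => cases J with
    | phi l m => exact hbp _ _ _ _ _ _
    | phiBar l m => exact hbb _ _ _ _ _ _
    | F a b => exact h0' rfl (M.comm_F_phiBar _ _ _ _ _ _)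
    | FBar a b => exact h0' rfl (z' _ _ _ _ _ _)
  | F c d => cases J with
    | phi l m => exact h0 rfl (M.comm_F_phi _ _ _ _ _ _)
    | phiBar l m => exact h0 rfl (M.comm_F_phiBar _ _ _ _ _ _)
    | F a b => exact h0 rfl (M.comm_F_F _ _ _ _ _ _)
    | FBar a b => exact hFF _ _ _ _ _ _
  | FBar c d => cases J with
    | phi l m => exact h0 rfl (z _ _ _ _ _ _)
    | phiBar l m => exact h0 rfl (z' _ _ _ _ _ _)
    | F a b => exact hswap (hFF _ _ _ _ _ _)
    | FBar a b => exact h0 rfl (M.comm_FBar_FBar hH hN _ _ _ _ _ _)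

lemma acomm_fermi_fermi {D : Test → Test → ℂ} (hD : IsWaveKernel D)
    (hanti : ∀ f g, D g f = -D f g)
    (hH : ∀ u v, form u v = conj (form v u)) (hN : ∀ u, (∀ v, form u v = 0) → u = 0)
    (h : ∀ j k l m f g, comm (M.bose (.phi j k) f) (M.bose (.phiBar l m) g) =
      boseKer D (.phi j k) (.phiBar l m) f g • 1) (I J : FermiField) (f g : Test) :
    acomm (M.fermi I f) (M.fermi J g) = fermiKer D I J f g • 1 := by
  have hbp (j k l m : Fin 4) (f g : Test) :=
    M.comm_bose_bose hD hanti hH hN h (.phiBar j k) (.phi l m) f g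
  have hl := M.acomm_lam_lamBar hH hN hbp
  cases I with
  | lam j a => cases J with
    | lam k b => exact (M.acomm_lam_lam j k a b f g).trans (zero_smul ℂ _).symm
    | lamBar k b => exact hl _ _ _ _ _ _
  | lamBar j a => cases J with
    | lam k b => rw [acomm_swap, hl, fermiKer_swap hD hanti]
    | lamBar k b => exact (M.acomm_lamBar_lamBar hH hN j k a b f g).trans (zero_smul ℂ _).symm

end Multiplet

end N4

theorem mainTheorem10 :
    -- the causal (anti)commutators of every multiplet
    (∀ (V : Type*) [AddCommGroup V] [Module ℂ V] (form : V →ₗ⋆[ℂ] V →ₗ[ℂ] ℂ),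
      (∀ u v, form u v = (starRingEnd ℂ) (form v u)) →
      (∀ u, (∀ v, form u v = 0) → u = 0) →
      ∀ M : N4.Multiplet form,
        (∀ j k l m f g,
          N4.comm (M.bose (.phi j k) f) (M.bose (.phiBar l m) g) =
            (-Complex.I * (N4.kron j l * N4.kron k m - N4.kron j m * N4.kron k l) *
              N4.pauliJordan f g) • 1) →
        (∀ I J f g, N4.comm (M.bose I f) (M.bose J g) =
            N4.boseKer N4.pauliJordan I J f g • 1) ∧
        (∀ I J f g, N4.acomm (M.fermi I f) (M.fermi J g) =
            N4.fermiKer N4.pauliJordan I J f g • 1) ∧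
        (∀ I J f g, N4.comm (M.bose I f) (M.fermi J g) = 0) ∧
        (∀ μ ν ρ σ f g, N4.comm (M.tensorF μ ν f) (M.tensorF ρ σ g) =
            N4.tensorKer N4.pauliJordan μ ν ρ σ f g • 1)) ∧
    -- the relations for `F_{ab}` and for `F_{μν}` can replace each other
    (∀ (V : Type*) [AddCommGroup V] [Module ℂ V] (form : V →ₗ⋆[ℂ] V →ₗ[ℂ] ℂ),
      (∀ u v, form u v = (starRingEnd ℂ) (form v u)) →
      (∀ u, (∀ v, form u v = 0) → u = 0) →
      ∀ M : N4.Multiplet form,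
        (∀ a b c d f g, N4.comm (M.bose (.F a b) f) (M.bose (.FBar c d) g) =
            N4.spinorKer N4.pauliJordan a b c d f g • 1) ↔
        (∀ μ ν ρ σ f g, N4.comm (M.tensorF μ ν f) (M.tensorF ρ σ g) =
            N4.tensorKer N4.pauliJordan μ ν ρ σ f g • 1)) ∧
    -- covariance of the commutators of the scalar fields under the internal symmetry group
    (∀ U ∈ Matrix.specialUnitaryGroup (Fin 4) ℂ, ∀ j k l m f g,
      (∑ j', ∑ k', ∑ l', ∑ m', U j j' * U k k' * star (U l l') * star (U m m') *
          N4.boseKer N4.pauliJordan (.phi j' k') (.phiBar l' m') f g) =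
        N4.boseKer N4.pauliJordan (.phi j k) (.phiBar l m) f g ∧
      (∑ j', ∑ k', ∑ l', ∑ m', U j j' * U k k' * U l l' * U m m' *
          N4.boseKer N4.pauliJordan (.phi j' k') (.phi l' m') f g) =
        N4.boseKer N4.pauliJordan (.phi j k) (.phi l m) f g) ∧
    -- compatibility with the constraints, in both arguments
    (∀ J g, N4.BoseConstraints (fun I f => N4.boseKer N4.pauliJordan I J f g)) ∧
    (∀ I f, N4.BoseConstraints (fun J g => N4.boseKer N4.pauliJordan I J f g)) ∧
    (∀ J g, N4.FermiConstraints (fun I f => N4.fermiKer N4.pauliJordan I J f g)) ∧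
    (∀ I f, N4.FermiConstraints (fun J g => N4.fermiKer N4.pauliJordan I J f g)) ∧
    (∀ ρ σ g, N4.TensorConstraints (fun μ ν f => N4.tensorKer N4.pauliJordan μ ν ρ σ f g)) ∧
    (∀ μ ν f, N4.TensorConstraints (fun ρ σ g => N4.tensorKer N4.pauliJordan μ ν ρ σ f g)) ∧
    -- positivity
    N4.Positivity N4.BoseField.bar (N4.boseKer N4.pauliJordanPlus) ∧
    N4.Positivity N4.FermiField.bar (N4.fermiKer N4.pauliJordanPlus) ∧
    N4.Positivity (ι := Fin 4 × Fin 4) id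
      (fun I J => N4.tensorKer N4.pauliJordanPlus I.1 I.2 J.1 J.2) := by
  have hD := N4.isWaveKernel_pauliJordan
  have ha := N4.pauliJordan_swap
  refine ⟨fun V _ _ form hH hN M h => ?_, fun V _ _ form hH hN M => ?_, fun U hU j k l m f g => ?_,
    fun J g => N4.boseConstraints_boseKer hD J g, fun I f => ?_,
    fun J g => N4.fermiConstraints_fermiKer hD J g, fun I f => ?_,
    fun ρ σ g => N4.tensorConstraints_tensorKer hD ρ σ g, fun μ ν f => ?_,
    N4.positivity_boseKer, N4.positivity_fermiKer, N4.positivity_tensorKer⟩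
  · have hB := M.comm_bose_bose hD ha hH hN h
    exact ⟨hB, M.acomm_fermi_fermi hD ha hH hN h, M.comm_bose_fermi,
      M.comm_tensorF_of_spinor hD ha hH hN fun a b c d => hB (.F a b) (.FBar c d)⟩
  · exact ⟨M.comm_tensorF_of_spinor hD ha hH hN, M.comm_spinor_of_tensorF hD⟩
  · have hU' := Matrix.mem_specialUnitaryGroup_iff.1 hU
    exact ⟨N4.boseKer_phi_phiBar_covariant _ hU'.1 j k l m f g,
      N4.boseKer_phi_phi_covariant _ hU'.2 j k l m f g⟩
  -- Constraints in the second argument reduce to the first by exchange, with a sign for commutators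
  -- and none for anticommutators.
  · have h := (N4.boseConstraints_boseKer hD I f).neg
    have e : (fun J g => N4.boseKer N4.pauliJordan I J f g) =
        -fun J g => N4.boseKer N4.pauliJordan J I g f := by
      funext J g; exact N4.boseKer_swap hD ha J I g f
    rwa [e]
  · have h := N4.fermiConstraints_fermiKer hD I f
    have e : (fun J g => N4.fermiKer N4.pauliJordan I J f g) =
        fun J g => N4.fermiKer N4.pauliJordan J I g f := by
      funext J g; exact N4.fermiKer_swap hD ha J I g f
    rwa [e]
  · have h := (N4.tensorConstraints_tensorKer hD μ ν f).neg
    have e : (fun ρ σ g => N4.tensorKer N4.pauliJordan μ ν ρ σ f g) =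
        -fun ρ σ g => N4.tensorKer N4.pauliJordan ρ σ μ ν g f := by
      funext ρ σ g; exact N4.tensorKer_swap hD ha ρ σ μ ν g f
    rwa [e]
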